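/- Let $(M^m,g)$ be a smooth Riemannian manifold of dimension $m$ and $(N^{2n},J,h)$ a Hermitian manifold of real dimension $2n$, with $m>2n$. For a smooth map $\varphi:M\to N$ and a Riemannian metric $\bar g$ on $M$, let $d\varphi^*$ be the pointwise adjoint of $d\varphi$ with respect to $\bar g$ and $h$, and let $\tau_{\bar g}(\varphi)=\operatorname{trace}_{\bar g}\nabla d\varphi$ be the tension field (formed with the Levi-Civita connections of $\bar g$ and $h$). The map $\varphi$ is called \emph{pseudo horizontally weakly conformal} (PHWC) with respect to $\bar g$ if $[d\varphi\circ d\varphi^{*},J]=0$ at every point, \emph{harmonic} if $\tau_{\bar g}(\varphi)=0$, and a \emph{pseudo-harmonic morphism} with respect to $\bar g$ if it is both harmonic and PHWC. Let $\varphi:(M^m,g)\to(N^{2n},J,h)$ be a PHWC submersion. Put $\mathcal V=\ker d\varphi$, let $\mathcal H$ be the $g$-orthogonal complement of $\mathcal V$ in $TM$, and let $g^{\mathcal V}(X,Y)=g(\mathcal V X,\mathcal V Y)$, $g^{\mathcal H}(X,Y)=g(\mathcal H X,\mathcal H Y)$ be the corresponding parts of $g$, where $\mathcal VX$ and $\mathcal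 HX$ are the $g$-orthogonal projections of $X$, so that $g=g^{\mathcal H}+g^{\mathcal V}$. For any smooth function $\sigma:M\to(0,\infty)$, $$g_\sigma=\sigma^{-2}g^{\mathcal H}+\sigma^{\frac{4n-4}{m-2n}}g^{\mathcal V}$$ is a smooth Riemannian metric on $M$, and $\varphi$ is a pseudo-harmonic morphism with respect to $g$ if and only if it is a pseudo-harmonic morphism with respect to $g_\sigma$. -/

import Mathlib

open Bundle
open scoped Manifold ContDiff

noncomputable section

namespace PseudoHarmonic

/-! ### Riemannian metrics and Hermitian manifolds -/

/-- A smooth Riemannian metric on a smooth `k`-dimensional manifold. -/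
abbrev Metric (k : ℕ) (M : Type*) [TopologicalSpace M]
    [ChartedSpace (EuclideanSpace ℝ (Fin k)) M] [IsManifold (𝓡 k) ∞ M] :=
  ContMDiffRiemannianMetric (𝓡 k) ∞ (EuclideanSpace ℝ (Fin k)) (TangentSpace (𝓡 k) : M → Type)

/-- A Hermitian structure `(J, h)` on a smooth real `k`-dimensional manifold: a smooth Riemannian
metric `h` and a smooth, `h`-orthogonal, integrable almost complex structure `J`.
Integrability is the vanishing of the Nijenhuis tensor
`[JX, JY] - J[JX, Y] - J[X, JY] - [X, Y]`. -/
structure HermitianStructure (k : ℕ) (N : Type*) [TopologicalSpace N]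
    [ChartedSpace (EuclideanSpace ℝ (Fin k)) N] [IsManifold (𝓡 k) ∞ N] where
  /-- the metric -/
  h : Metric k N
  /-- the complex structure on the tangent spaces -/
  J (x : N) : TangentSpace (𝓡 k) x →L[ℝ] TangentSpace (𝓡 k) x
  smooth_J : ContMDiff (𝓡 k)
    ((𝓡 k).prod 𝓘(ℝ, EuclideanSpace ℝ (Fin k) →L[ℝ] EuclideanSpace ℝ (Fin k))) ∞
    (fun x => TotalSpace.mk' (EuclideanSpace ℝ (Fin k) →L[ℝ] EuclideanSpace ℝ (Fin k))
      (E := fun x : N => TangentSpace (𝓡 k) x →L[ℝ] TangentSpace (𝓡 k) x) x (J x))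
  J_sq (x : N) (v : TangentSpace (𝓡 k) x) : J x (J x v) = -v
  h_J (x : N) (v w : TangentSpace (𝓡 k) x) : h.inner x (J x v) (J x w) = h.inner x v w
  integrable (x : N) (X Y : ∀ y : N, TangentSpace (𝓡 k) y)
    (hX : ContMDiffAt (𝓡 k) (𝓡 k).tangent ∞
      (fun y => (⟨y, X y⟩ : TangentBundle (𝓡 k) N)) x)
    (hY : ContMDiffAt (𝓡 k) (𝓡 k).tangent ∞
      (fun y => (⟨y, Y y⟩ : TangentBundle (𝓡 k) N)) x) :
    VectorField.mlieBracket (𝓡 k) (fun y => J y (X y)) (fun y => J y (Y y)) x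
      - J x (VectorField.mlieBracket (𝓡 k) (fun y => J y (X y)) Y x)
      - J x (VectorField.mlieBracket (𝓡 k) X (fun y => J y (Y y)) x)
      - VectorField.mlieBracket (𝓡 k) X Y x = 0

section Linear

variable {m k : ℕ}
  {M : Type*} [TopologicalSpace M] [ChartedSpace (EuclideanSpace ℝ (Fin m)) M]
  [IsManifold (𝓡 m) ∞ M]
  {N : Type*} [TopologicalSpace N] [ChartedSpace (EuclideanSpace ℝ (Fin k)) N]

instance (x : M) : FiniteDimensional ℝ (TangentSpace (𝓡 m) x) :=
  inferInstanceAs (FiniteDimensional ℝ (EuclideanSpace ℝ (Fin m)))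

/-- The metric at a point, as a bilinear form on the tangent space. -/
def form (g : Metric m M) (x : M) : LinearMap.BilinForm ℝ (TangentSpace (𝓡 m) x) :=
  LinearMap.mk₂ ℝ (fun v w => g.inner x v w) (by simp) (by simp) (by simp) (by simp)

theorem form_apply (g : Metric m M) (x : M) (v w : TangentSpace (𝓡 m) x) :
    form g x v w = g.inner x v w := rfl

theorem form_eq_zero (g : Metric m M) (x : M) {v : TangentSpace (𝓡 m) x}
    (h : form g x v v = 0) : v = 0 := by
  by_contra hv
  exact (g.pos x v hv).ne' h

theorem form_isRefl (g : Metric m M) (x : M) : (form g x).IsRefl := by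
  intro v w h
  rw [form_apply] at h ⊢
  rw [g.symm, h]

theorem form_nondegenerate (g : Metric m M) (x : M) : (form g x).Nondegenerate :=
  ⟨fun v h => form_eq_zero g x (h v), fun v h => form_eq_zero g x (h v)⟩

/-- The differential of `φ` at `x`, as a linear map. -/
def differential (φ : M → N) (x : M) :
    TangentSpace (𝓡 m) x →ₗ[ℝ] TangentSpace (𝓡 k) (φ x) :=
  (mfderiv (𝓡 m) (𝓡 k) φ x).toLinearMap

/-- The vertical space `𝒱ₓ = ker dφₓ`. -/
def vertical (φ : M → N) (x : M) : Submodule ℝ (TangentSpace (𝓡 m) x) :=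
  LinearMap.ker (differential (k := k) φ x)

/-- The horizontal space `ℋₓ`, the `g`-orthogonal complement of `𝒱ₓ`. -/
def horizontal (g : Metric m M) (φ : M → N) (x : M) : Submodule ℝ (TangentSpace (𝓡 m) x) :=
  (form g x).orthogonal (vertical (k := k) φ x)

theorem isCompl_vertical_horizontal (g : Metric m M) (φ : M → N) (x : M) :
    IsCompl (vertical (k := k) φ x) (horizontal (k := k) g φ x) := by
  refine ((form g x).isCompl_orthogonal_iff_disjoint (form_isRefl g x)).2 ?_
  rw [Submodule.disjoint_def]
  intro v hv hv'
  exact form_eq_zero g x (hv' v hv)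

/-- The `g`-orthogonal projection onto `𝒱ₓ` (along `ℋₓ`). -/
def verticalProj (g : Metric m M) (φ : M → N) (x : M) :
    TangentSpace (𝓡 m) x →ₗ[ℝ] TangentSpace (𝓡 m) x :=
  Submodule.projection _ _ (isCompl_vertical_horizontal (k := k) g φ x)

/-- The `g`-orthogonal projection onto `ℋₓ` (along `𝒱ₓ`). -/
def horizontalProj (g : Metric m M) (φ : M → N) (x : M) :
    TangentSpace (𝓡 m) x →ₗ[ℝ] TangentSpace (𝓡 m) x :=
  Submodule.projection _ _ (isCompl_vertical_horizontal (k := k) g φ x).symm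

/-- The vertical part `g^𝒱` of the metric `g`, with respect to `φ`. -/
def verticalPart (g : Metric m M) (φ : M → N) (x : M) (v w : TangentSpace (𝓡 m) x) : ℝ :=
  g.inner x (verticalProj (k := k) g φ x v) (verticalProj (k := k) g φ x w)

/-- The horizontal part `g^ℋ` of the metric `g`, with respect to `φ`. -/
def horizontalPart (g : Metric m M) (φ : M → N) (x : M) (v w : TangentSpace (𝓡 m) x) : ℝ :=
  g.inner x (horizontalProj (k := k) g φ x v) (horizontalProj (k := k) g φ x w)

/-- A smooth map all of whose differentials are onto. -/
def IsSubmersion (m k : ℕ) {M : Type*} [TopologicalSpace M]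
    [ChartedSpace (EuclideanSpace ℝ (Fin m)) M] {N : Type*} [TopologicalSpace N]
    [ChartedSpace (EuclideanSpace ℝ (Fin k)) N] (φ : M → N) : Prop :=
  ContMDiff (𝓡 m) (𝓡 k) ∞ φ ∧ ∀ x, Function.Surjective (mfderiv (𝓡 m) (𝓡 k) φ x)

variable [IsManifold (𝓡 k) ∞ N]

/-- The adjoint `dφ*` of the differential of `φ : (M, g) → (N, h)` at `x`. -/
def adjointDifferential (g : Metric m M) (h : Metric k N) (φ : M → N) (x : M) :
    TangentSpace (𝓡 k) (φ x) →ₗ[ℝ] TangentSpace (𝓡 m) x :=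
  ((form g x).toDual (form_nondegenerate g x)).symm.toLinearMap ∘ₗ
    (differential φ x).dualMap ∘ₗ
      ((form h (φ x)).toDual (form_nondegenerate h (φ x))).toLinearMap

theorem adjointDifferential_spec (g : Metric m M) (h : Metric k N) (φ : M → N) (x : M)
    (w : TangentSpace (𝓡 k) (φ x)) (v : TangentSpace (𝓡 m) x) :
    g.inner x (adjointDifferential g h φ x w) v = h.inner (φ x) w (differential φ x v) := by
  have h1 := (form g x).apply_toDual_symm_apply (hB := form_nondegenerate g x)
    ((differential φ x).dualMap ((form h (φ x)).toDual (form_nondegenerate h (φ x)) w)) v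
  exact h1

/-- Pseudo horizontal weak conformality: `[dφ ∘ dφ*, J] = 0` at every point. -/
def IsPHWC (g : Metric m M) (S : HermitianStructure k N) (φ : M → N) : Prop :=
  ∀ (x : M) (w : TangentSpace (𝓡 k) (φ x)),
    differential φ x (adjointDifferential g S.h φ x (S.J (φ x) w)) =
      S.J (φ x) (differential φ x (adjointDifferential g S.h φ x w))

end Linear

/-! ### The tension field, in charts -/

/-- The `i`-th partial derivative of a function on `ℝᵏ`. -/
def partialDeriv {k : ℕ} (i : Fin k) (f : EuclideanSpace ℝ (Fin k) → ℝ) :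
    EuclideanSpace ℝ (Fin k) → ℝ :=
  fun y => fderiv ℝ f y (EuclideanSpace.single i 1)

/-- The Christoffel symbol `Γᵃᵢⱼ = ½ ∑ₗ Gᵃˡ (∂ᵢ Gⱼₗ + ∂ⱼ Gᵢₗ - ∂ₗ Gᵢⱼ)` of a matrix-valued function
`G` on `ℝᵏ`. -/
def christoffel {k : ℕ} (G : EuclideanSpace ℝ (Fin k) → Matrix (Fin k) (Fin k) ℝ)
    (a i j : Fin k) (y : EuclideanSpace ℝ (Fin k)) : ℝ :=
  (1 / 2) * ∑ l, (G y)⁻¹ a l *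
    (partialDeriv i (fun z => G z j l) y + partialDeriv j (fun z => G z i l) y
      - partialDeriv l (fun z => G z i j) y)

section Tension

variable {m k : ℕ}
  {M : Type*} [TopologicalSpace M] [ChartedSpace (EuclideanSpace ℝ (Fin m)) M]
  [IsManifold (𝓡 m) ∞ M]
  {N : Type*} [TopologicalSpace N] [ChartedSpace (EuclideanSpace ℝ (Fin k)) N]
  [IsManifold (𝓡 k) ∞ N]

/-- The `i`-th coordinate vector field of the preferred chart at `x₀`, at the point with
coordinates `y`. -/
def coordVec (x₀ : M) (i : Fin m) (y : EuclideanSpace ℝ (Fin m)) :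
    TangentSpace (𝓡 m) ((extChartAt (𝓡 m) x₀).symm y) :=
  mfderiv 𝓘(ℝ, EuclideanSpace ℝ (Fin m)) (𝓡 m) (extChartAt (𝓡 m) x₀).symm y
    (EuclideanSpace.single i (1 : ℝ) : EuclideanSpace ℝ (Fin m))

/-- The components `gᵢⱼ` of the metric in the preferred chart at `x₀`. -/
def metricMatrix (g : Metric m M) (x₀ : M) (y : EuclideanSpace ℝ (Fin m)) :
    Matrix (Fin m) (Fin m) ℝ :=
  Matrix.of fun i j =>
    g.inner ((extChartAt (𝓡 m) x₀).symm y) (coordVec x₀ i y) (coordVec x₀ j y)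

/-- The `c`-th component of `φ` in the preferred charts at `x₀` and `φ x₀`. -/
def localComp (φ : M → N) (x₀ : M) (c : Fin k) (y : EuclideanSpace ℝ (Fin m)) : ℝ :=
  (writtenInExtChartAt (𝓡 m) (𝓡 k) x₀ φ y : EuclideanSpace ℝ (Fin k)) c

/-- The tension field `τ(φ) = trace_g ∇dφ` of a map `φ : (M, g) → (N, h)`, at `x`. Its components
in the preferred charts at `x` and `φ x` are
`τᶜ = gⁱʲ (∂ᵢ∂ⱼφᶜ - Γᵃᵢⱼ ∂ₐφᶜ + (Γᴺᶜ_pq ∘ φ) ∂ᵢφᵖ ∂ⱼφ^q)`. (The coordinates of a vector of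
`TangentSpace (𝓡 k) (φ x)` are those in the preferred chart at `φ x`.) -/
def tensionField (g : Metric m M) (h : Metric k N) (φ : M → N) (x : M) :
    TangentSpace (𝓡 k) (φ x) :=
  let y := extChartAt (𝓡 m) x x
  (WithLp.toLp 2 fun c : Fin k => ∑ i, ∑ j, (metricMatrix g x y)⁻¹ i j *
    (partialDeriv i (partialDeriv j (localComp φ x c)) y
      - ∑ a, christoffel (metricMatrix g x) a i j y * partialDeriv a (localComp φ x c) y
      + ∑ p, ∑ q, christoffel (metricMatrix h (φ x)) c p q (extChartAt (𝓡 k) (φ x) (φ x))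
          * partialDeriv i (localComp φ x p) y * partialDeriv j (localComp φ x q) y) :
    EuclideanSpace ℝ (Fin k))

/-- A harmonic map: a smooth map with vanishing tension field. -/
def IsHarmonic (g : Metric m M) (h : Metric k N) (φ : M → N) : Prop :=
  ContMDiff (𝓡 m) (𝓡 k) ∞ φ ∧ ∀ x, tensionField g h φ x = 0

/-- A pseudo-harmonic morphism: a harmonic map that is pseudo horizontally weakly conformal. -/
def IsPseudoHarmonicMorphism (g : Metric m M) (S : HermitianStructure k N) (φ : M → N) : Prop :=
  IsHarmonic g S.h φ ∧ IsPHWC g S φ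

end Tension

end PseudoHarmonic

end

/-! Consider any metric g' = a g^ℋ + t g^𝒱 with positive smooth a, t. On a horizontal vector paired
with anything, g' is a·g, so every object dual to dφ is divided by a: both dφ*
(`adjointDifferential_biconformalMetric`) and the gradients of the chart components of φ, whose
values are horizontal (`biconformalGram_inv_mul_transpose`). Hence dφ∘dφ* only changes by a scalar
function, and commuting with J is unaffected.

For the tension field, the term with the Christoffel symbols of h contains one gradient, so it is
divided by a. The other term is the Laplacian of each component, that is, the divergence of its
gradient for the volume density √det G. With k = dim N, the density is multiplied by the square root
of t^(m-k) a^k (`det_biconformalGram`). If this root equals a, then density times gradient is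
unchanged, and the Laplacian is also divided by a (`coordLaplacian_of_gradient_eq`). So τ' = a⁻¹ τ
(`tensionField_biconformalMetric`), and the two zero sets agree. For k = 2n and a = σ⁻², the given
power of σ is the t that balances the density (`rpow_balance`).

Smoothness of g' comes from the formula Aᵀ(A G⁻¹ Aᵀ)⁻¹A for the matrix of g^ℋ in charts, where A is
the Jacobian matrix of φ and G the matrix of g (`horizontalPart_frame`). -/

open Bundle
open scoped Manifold ContDiff

noncomputable section

namespace PseudoHarmonic

/-! ### Biconformal changes of a Gram matrix -/

section MatrixAlgebra

open Matrix

variable {ι κ : Type*} [Fintype ι] [DecidableEq ι] [Fintype κ] [DecidableEq κ]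

/-- The projection, orthogonal for the Gram matrix `G`, onto the `G`-orthogonal complement of the
kernel of `A`. -/
def orthProj (G : Matrix ι ι ℝ) (A : Matrix κ ι ℝ) : Matrix ι ι ℝ :=
  G⁻¹ * Aᵀ * (A * G⁻¹ * Aᵀ)⁻¹ * A

/-- The Gram matrix of the part of `G` which is horizontal with respect to `A`. -/
def horizontalGram (G : Matrix ι ι ℝ) (A : Matrix κ ι ℝ) : Matrix ι ι ℝ :=
  Aᵀ * (A * G⁻¹ * Aᵀ)⁻¹ * A

/-- The Gram matrix obtained from `G` by scaling its horizontal part by `a` and its vertical part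
by `t`. -/
def biconformalGram (a t : ℝ) (G : Matrix ι ι ℝ) (A : Matrix κ ι ℝ) : Matrix ι ι ℝ :=
  a • horizontalGram G A + t • (G - horizontalGram G A)

variable {G : Matrix ι ι ℝ} {A : Matrix κ ι ℝ}

theorem isUnit_det_of_posDef (hG : G.PosDef) : IsUnit G.det :=
  isUnit_iff_ne_zero.2 hG.det_pos.ne'

/-- Surjectivity of A makes its transpose injective, so A G⁻¹ Aᵀ inherits positive definiteness from
G⁻¹. -/
theorem isUnit_det_mul_inv_mul_transpose (hG : G.PosDef) (hA : Function.Surjective A.mulVec) :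
    IsUnit (A * G⁻¹ * Aᵀ).det := by
  have hinj : Function.Injective A.vecMul := by
    intro v w hvw
    have h : ∀ u, v ⬝ᵥ u = w ⬝ᵥ u := by
      intro u
      obtain ⟨z, rfl⟩ := hA u
      rw [dotProduct_mulVec, dotProduct_mulVec]
      exact congrArg (· ⬝ᵥ z) hvw
    funext i
    simpa using h (Pi.single i 1)
  have h := hG.inv.mul_mul_conjTranspose_same (B := A) hinj
  rw [conjTranspose_eq_transpose_of_trivial] at h
  exact isUnit_det_of_posDef h

theorem mul_orthProj_left (hG : G.PosDef) : G * orthProj G A = horizontalGram G A := by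
  simp only [orthProj, horizontalGram, ← Matrix.mul_assoc]
  rw [mul_nonsing_inv _ (isUnit_det_of_posDef hG), Matrix.one_mul]

theorem mul_orthProj (hG : G.PosDef) (hA : Function.Surjective A.mulVec) :
    A * orthProj G A = A := by
  simp only [orthProj, ← Matrix.mul_assoc]
  rw [mul_nonsing_inv _ (isUnit_det_mul_inv_mul_transpose hG hA), Matrix.one_mul]

/-- The columns of G⁻¹Aᵀ span the horizontal space, so the horizontal part of G acts on them as G
does. -/
theorem horizontalGram_mul_inv_mul_transpose (hG : G.PosDef) (hA : Function.Surjective A.mulVec) :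
    horizontalGram G A * (G⁻¹ * Aᵀ) = Aᵀ := by
  simp only [horizontalGram, Matrix.mul_assoc]
  rw [← Matrix.mul_assoc A, nonsing_inv_mul _ (isUnit_det_mul_inv_mul_transpose hG hA),
    Matrix.mul_one]

/-- Factoring out t·G leaves the identity plus a product through ℝ^κ; the identity det(1 + XY) =
det(1 + YX) turns this into the determinant of the scalar κ × κ matrix a/t. -/
theorem det_biconformalGram (hG : G.PosDef) (hA : Function.Surjective A.mulVec) (a : ℝ) {t : ℝ}
    (ht : t ≠ 0) :
    (biconformalGram a t G A).det = t ^ Fintype.card ι * (a / t) ^ Fintype.card κ * G.det := by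
  have h : biconformalGram a t G A =
      t • (G * (1 + (G⁻¹ * Aᵀ) * ((a / t - 1) • ((A * G⁻¹ * Aᵀ)⁻¹ * A)))) := by
    have h1 : G * ((G⁻¹ * Aᵀ) * ((a / t - 1) • ((A * G⁻¹ * Aᵀ)⁻¹ * A))) =
        (a / t - 1) • horizontalGram G A := by
      rw [← mul_orthProj_left hG, orthProj]
      simp only [Matrix.mul_smul, Matrix.mul_assoc]
    rw [mul_add, h1, Matrix.mul_one, biconformalGram]
    ext i j
    simp only [Matrix.add_apply, Matrix.smul_apply, Matrix.sub_apply, smul_eq_mul]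
    field_simp
    ring
  have h2 : ((a / t - 1) • ((A * G⁻¹ * Aᵀ)⁻¹ * A)) * (G⁻¹ * Aᵀ) =
      (a / t - 1) • (1 : Matrix κ κ ℝ) := by
    rw [Matrix.smul_mul, Matrix.mul_assoc, ← Matrix.mul_assoc A,
      nonsing_inv_mul _ (isUnit_det_mul_inv_mul_transpose hG hA)]
  have h3 : (1 : Matrix κ κ ℝ) + (a / t - 1) • (1 : Matrix κ κ ℝ) = (a / t) • 1 := by
    rw [sub_smul, one_smul]; abel
  rw [h, det_smul, det_mul, det_one_add_mul_comm, h2, h3, det_smul, det_one]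
  ring

/-- The vertical part kills G⁻¹Aᵀ and the horizontal part is scaled by a, so the new matrix sends
a⁻¹G⁻¹Aᵀ to Aᵀ. -/
theorem biconformalGram_inv_mul_transpose (hG : G.PosDef) (hA : Function.Surjective A.mulVec)
    {a t : ℝ} (ha : a ≠ 0) (ht : t ≠ 0) :
    (biconformalGram a t G A)⁻¹ * Aᵀ = a⁻¹ • (G⁻¹ * Aᵀ) := by
  have hu : IsUnit (biconformalGram a t G A).det := by
    rw [det_biconformalGram hG hA a ht]
    exact isUnit_iff_ne_zero.2 (mul_ne_zero (mul_ne_zero (pow_ne_zero _ ht)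
      (pow_ne_zero _ (div_ne_zero ha ht))) hG.det_pos.ne')
  have h : biconformalGram a t G A * (a⁻¹ • (G⁻¹ * Aᵀ)) = Aᵀ := by
    rw [biconformalGram, Matrix.mul_smul, Matrix.add_mul, Matrix.smul_mul, Matrix.smul_mul,
      Matrix.sub_mul, horizontalGram_mul_inv_mul_transpose hG hA, ← Matrix.mul_assoc,
      mul_nonsing_inv _ (isUnit_det_of_posDef hG), Matrix.one_mul, sub_self, smul_zero, add_zero,
      smul_smul, inv_mul_cancel₀ ha, one_smul]
  calc (biconformalGram a t G A)⁻¹ * Aᵀ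
      = (biconformalGram a t G A)⁻¹ * (biconformalGram a t G A * (a⁻¹ • (G⁻¹ * Aᵀ))) := by rw [h]
    _ = _ := by rw [← Matrix.mul_assoc, nonsing_inv_mul _ hu, Matrix.one_mul]

end MatrixAlgebra

/-! ### Differentiating matrix-valued functions -/

section MatrixCalculus

open Matrix

variable {E : Type*} [NormedAddCommGroup E] [NormedSpace ℝ E]
  {ι κ μ : Type*}

theorem contDiffAt_matrix_mul [Fintype κ] {n : WithTop ℕ∞} {A : E → Matrix μ κ ℝ} {B : E → Matrix κ ι ℝ} {y : E}
    (hA : ∀ i j, ContDiffAt ℝ n (fun z => A z i j) y)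
    (hB : ∀ i j, ContDiffAt ℝ n (fun z => B z i j) y) (i : μ) (j : ι) :
    ContDiffAt ℝ n (fun z => (A z * B z) i j) y := by
  simp only [mul_apply]
  exact ContDiffAt.sum fun l _ => (hA i l).mul (hB l j)

variable [Fintype ι] [DecidableEq ι]

theorem contDiffAt_matrix_det {n : WithTop ℕ∞} {G : E → Matrix ι ι ℝ} {y : E}
    (hG : ∀ i j, ContDiffAt ℝ n (fun z => G z i j) y) :
    ContDiffAt ℝ n (fun z => (G z).det) y := by
  simp only [det_apply']
  exact ContDiffAt.sum fun s _ => contDiffAt_const.mul (contDiffAt_prod fun i _ => hG _ _)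

theorem contDiffAt_matrix_inv {n : WithTop ℕ∞} {G : E → Matrix ι ι ℝ} {y : E}
    (hG : ∀ i j, ContDiffAt ℝ n (fun z => G z i j) y) (hdet : IsUnit (G y).det) (i j : ι) :
    ContDiffAt ℝ n (fun z => (G z)⁻¹ i j) y := by
  simp only [inv_def, Matrix.smul_apply, smul_eq_mul, Ring.inverse_eq_inv', adjugate_apply]
  refine ((contDiffAt_matrix_det hG).inv hdet.ne_zero).mul (contDiffAt_matrix_det fun a b => ?_)
  -- By Cramer's rule the numerator is the determinant of G with row j replaced by a constant
  -- vector.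
  by_cases h : a = j
  · subst h
    simp only [updateRow_self]
    exact contDiffAt_const
  · simp only [updateRow_ne h]
    exact hG a b

/-- Write det(G + tD) = det G · det(1 + t G⁻¹D); the second factor is a polynomial in t of the form
1 + t·tr(G⁻¹D) + t²·q(t). -/
theorem hasDerivAt_det_add_smul (G D : Matrix ι ι ℝ) (hG : IsUnit G.det) :
    HasDerivAt (fun t : ℝ => (G + t • D).det) (G.det * (G⁻¹ * D).trace) 0 := by
  have h : (fun t : ℝ => (G + t • D).det) = fun t => G.det *
      (1 + (G⁻¹ * D).trace * t +
        ((1 + (Polynomial.X : Polynomial ℝ) •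
          (G⁻¹ * D).map Polynomial.C).det.divX.divX).eval t * t ^ 2) := by
    funext t
    rw [← det_one_add_smul, ← det_mul, mul_add, Matrix.mul_one, Matrix.mul_smul,
      ← Matrix.mul_assoc, mul_nonsing_inv _ hG, Matrix.one_mul]
  rw [h]
  have h2 := ((((hasDerivAt_id (0 : ℝ)).const_mul (G⁻¹ * D).trace).const_add 1).add
    ((((1 + (Polynomial.X : Polynomial ℝ) •
          (G⁻¹ * D).map Polynomial.C).det.divX.divX).hasDerivAt 0).mul
      ((hasDerivAt_id (0 : ℝ)).pow 2))).const_mul G.det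
  refine h2.congr_deriv ?_
  simp

/-- Jacobi's formula. By the chain rule only the derivative of det at G y in the direction D
matters, and it can be read off along the line G y + tD. -/
theorem fderiv_matrix_det {G : E → Matrix ι ι ℝ} {y : E}
    (hG : ∀ i j, DifferentiableAt ℝ (fun z => G z i j) y) (hdet : IsUnit (G y).det) (v : E) :
    fderiv ℝ (fun z => (G z).det) y v = (G y).det *
      ((G y)⁻¹ * Matrix.of fun i j => fderiv ℝ (fun z => G z i j) y v).trace := by
  set D : Matrix ι ι ℝ := Matrix.of fun i j => fderiv ℝ (fun z => G z i j) y v with hD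
  let d : (ι → ι → ℝ) → ℝ := fun A => (Matrix.of A).det
  have hd : DifferentiableAt ℝ d (fun i j => G y i j) :=
    (contDiffAt_matrix_det (n := 1) (G := fun A : ι → ι → ℝ => Matrix.of A)
      fun i j => by simp only [of_apply]; fun_prop).differentiableAt one_ne_zero
  have hGd : HasFDerivAt (fun z => fun i j => G z i j)
      (ContinuousLinearMap.pi fun i => ContinuousLinearMap.pi fun j =>
        fderiv ℝ (fun z => G z i j) y) y :=
    hasFDerivAt_pi.2 fun i => hasFDerivAt_pi.2 fun j => (hG i j).hasFDerivAt
  have h1 : fderiv ℝ (fun z => (G z).det) y v = fderiv ℝ d (fun i j => G y i j) (fun i j => D i j) :=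
    congrArg (fun L => L v) (hd.hasFDerivAt.comp y hGd).fderiv
  have hline : HasDerivAt (fun t : ℝ => (fun i j => G y i j) + t • (fun i j => D i j : ι → ι → ℝ))
      (fun i j => D i j) 0 := by
    simpa using ((hasDerivAt_id (0 : ℝ)).smul_const (fun i j => D i j : ι → ι → ℝ)).const_add
      (fun i j => G y i j)
  have hd' : HasFDerivAt d (fderiv ℝ d (fun i j => G y i j))
      ((fun i j => G y i j) + (0 : ℝ) • (fun i j => D i j : ι → ι → ℝ)) := by
    rw [zero_smul, add_zero]; exact hd.hasFDerivAt
  rw [h1]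
  exact (hd'.comp_hasDerivAt (0 : ℝ) hline).unique (hasDerivAt_det_add_smul (G y) D hdet)

/-- Differentiate G⁻¹G = 1, which holds near y because the determinant stays nonzero there, then
multiply by G⁻¹ on the right. -/
theorem fderiv_matrix_inv {G : E → Matrix ι ι ℝ} {y : E}
    (hG : ∀ i j, ContDiffAt ℝ 1 (fun z => G z i j) y) (hdet : IsUnit (G y).det) (v : E) :
    (Matrix.of fun i j => fderiv ℝ (fun z => (G z)⁻¹ i j) y v) =
      -((G y)⁻¹ * (Matrix.of fun i j => fderiv ℝ (fun z => G z i j) y v) * (G y)⁻¹) := by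
  set D : Matrix ι ι ℝ := Matrix.of fun i j => fderiv ℝ (fun z => G z i j) y v with hD
  set D' : Matrix ι ι ℝ := Matrix.of fun i j => fderiv ℝ (fun z => (G z)⁻¹ i j) y v with hD'
  have hG' : ∀ i j, DifferentiableAt ℝ (fun z => G z i j) y :=
    fun i j => (hG i j).differentiableAt one_ne_zero
  have hI : ∀ i j, DifferentiableAt ℝ (fun z => (G z)⁻¹ i j) y :=
    fun i j => (contDiffAt_matrix_inv hG hdet i j).differentiableAt one_ne_zero
  have hev : ∀ᶠ z in nhds y, (G z).det ≠ 0 :=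
    (contDiffAt_matrix_det hG).continuousAt.eventually_ne hdet.ne_zero
  have key : D' * G y + (G y)⁻¹ * D = 0 := by
    ext i j
    have h1 : (fun z => ∑ l, (G z)⁻¹ i l * G z l j) =ᶠ[nhds y]
        fun _ => (1 : Matrix ι ι ℝ) i j := by
      filter_upwards [hev] with z hz
      rw [← mul_apply, nonsing_inv_mul _ (isUnit_iff_ne_zero.2 hz)]
    have h2 := congrArg (fun L : E →L[ℝ] ℝ => L v) h1.fderiv_eq
    rw [fderiv_fun_sum (A := fun l z => (G z)⁻¹ i l * G z l j)
      fun l _ => (hI i l).mul (hG' l j)] at h2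
    simp only [_root_.sum_apply, fderiv_fun_mul (hI i _) (hG' _ j)] at h2
    simp only [Matrix.add_apply, mul_apply, hD, hD', of_apply, Matrix.zero_apply,
      ← Finset.sum_add_distrib]
    simp only [fderiv_fun_const, _root_.add_apply, _root_.smul_apply,
      smul_eq_mul, Pi.zero_apply, _root_.zero_apply] at h2
    rw [← h2]
    exact Finset.sum_congr rfl fun l _ => by ring
  calc D' = D' * G y * (G y)⁻¹ := by rw [Matrix.mul_assoc, mul_nonsing_inv _ hdet, Matrix.mul_one]
    _ = _ := by rw [eq_neg_of_add_eq_zero_left key, Matrix.neg_mul]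

end MatrixCalculus

/-! ### The Laplacian of a function in coordinates -/

section Laplacian

open Matrix

variable {k : ℕ}

/-- The Laplacian `Gⁱʲ (∂ᵢ∂ⱼf - Γᵃᵢⱼ ∂ₐf)` of the metric with components `G`. -/
def coordLaplacian (G : EuclideanSpace ℝ (Fin k) → Matrix (Fin k) (Fin k) ℝ)
    (f : EuclideanSpace ℝ (Fin k) → ℝ) (y : EuclideanSpace ℝ (Fin k)) : ℝ :=
  ∑ i, ∑ j, (G y)⁻¹ i j *
    (partialDeriv i (partialDeriv j f) y - ∑ a, christoffel G a i j y * partialDeriv a f y)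

/-- The components `Gⁱʲ ∂ⱼf` of the gradient of `f`. -/
def coordGradient (G : EuclideanSpace ℝ (Fin k) → Matrix (Fin k) (Fin k) ℝ)
    (f : EuclideanSpace ℝ (Fin k) → ℝ) (i : Fin k) (y : EuclideanSpace ℝ (Fin k)) : ℝ :=
  ∑ j, (G y)⁻¹ i j * partialDeriv j f y

theorem ContDiffAt.partialDeriv {n n' : WithTop ℕ∞} {f : EuclideanSpace ℝ (Fin k) → ℝ}
    {y : EuclideanSpace ℝ (Fin k)} (hf : ContDiffAt ℝ n f y) (hn : n' + 1 ≤ n) (i : Fin k) :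
    ContDiffAt ℝ n' (PseudoHarmonic.partialDeriv i f) y :=
  (hf.fderiv_right hn).clm_apply contDiffAt_const

/-- The contracted Christoffel symbols `Gⁱʲ Γᵃᵢⱼ`. -/
theorem sum_inv_mul_christoffel {G : EuclideanSpace ℝ (Fin k) → Matrix (Fin k) (Fin k) ℝ}
    {y : EuclideanSpace ℝ (Fin k)} (hsymm : (G y).IsSymm)
    (hG : ∀ i j, ContDiffAt ℝ 1 (fun z => G z i j) y) (hdet : IsUnit (G y).det) (a : Fin k) :
    ∑ i, ∑ j, (G y)⁻¹ i j * christoffel G a i j y =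
      -(∑ i, partialDeriv i (fun z => (G z)⁻¹ i a) y)
        - (1 / 2) * ∑ l, (G y)⁻¹ l a * (partialDeriv l (fun z => (G z).det) y / (G y).det) := by
  set D : Fin k → Matrix (Fin k) (Fin k) ℝ := fun l =>
    Matrix.of fun i j => partialDeriv l (fun z => G z i j) y with hD
  have hI : ∀ i j, (G y)⁻¹ i j = (G y)⁻¹ j i := fun i j => by
    have h : ((G y)⁻¹)ᵀ = (G y)⁻¹ := by rw [transpose_nonsing_inv, hsymm]
    exact congrFun (congrFun h j) i
  set I := (G y)⁻¹ with hIdef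
  -- The contraction is ½(T₁ + T₂ - T₃), one sum for each term of the Christoffel symbol. Symmetry
  -- gives T₁ = T₂ (`h4`), the derivative of the inverse gives T₁ = -∑ᵢ ∂ᵢGⁱᵃ (`h2`), and Jacobi's
  -- formula turns T₃ into derivatives of log det (`h1`, `h5`).
  have h1 : ∀ l, partialDeriv l (fun z => (G z).det) y / (G y).det = ∑ i, ∑ j, I i j * D l j i := by
    intro l
    rw [partialDeriv, fderiv_matrix_det (fun i j => (hG i j).differentiableAt one_ne_zero) hdet,
      mul_div_cancel_left₀ _ hdet.ne_zero]
    rfl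
  have h2 : ∀ i, partialDeriv i (fun z => (G z)⁻¹ i a) y =
      -∑ j, ∑ l, I i j * D i j l * I l a := by
    intro i
    have h := congrFun (congrFun (fderiv_matrix_inv hG hdet (EuclideanSpace.single i 1)) i) a
    refine h.trans ?_
    rw [Matrix.neg_apply, mul_apply, Finset.sum_comm]
    simp only [mul_apply, Finset.sum_mul]
    rfl
  have h3 : ∑ i, ∑ j, I i j * christoffel G a i j y =
      (1 / 2) * ((∑ i, ∑ j, ∑ l, I i j * D i j l * I l a) + (∑ i, ∑ j, ∑ l, I i j * D j i l * I l a)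
        - ∑ i, ∑ j, ∑ l, I i j * D l i j * I l a) := by
    simp only [← Finset.sum_add_distrib, ← Finset.sum_sub_distrib, Finset.mul_sum, christoffel]
    refine Finset.sum_congr rfl fun i _ => Finset.sum_congr rfl fun j _ =>
      Finset.sum_congr rfl fun l _ => ?_
    rw [← hIdef, hI a l]
    simp only [hD, of_apply]
    ring
  have h4 : ∑ i, ∑ j, ∑ l, I i j * D j i l * I l a = ∑ i, ∑ j, ∑ l, I i j * D i j l * I l a := by
    rw [Finset.sum_comm]
    refine Finset.sum_congr rfl fun i _ => Finset.sum_congr rfl fun j _ =>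
      Finset.sum_congr rfl fun l _ => ?_
    rw [hI i j]
  have h5 : ∑ i, ∑ j, ∑ l, I i j * D l i j * I l a = ∑ l, I l a * ∑ i, ∑ j, I i j * D l j i := by
    simp only [Finset.mul_sum]
    calc _ = ∑ i, ∑ l, ∑ j, I i j * D l i j * I l a :=
          Finset.sum_congr rfl fun i _ => Finset.sum_comm
      _ = ∑ l, ∑ i, ∑ j, I i j * D l i j * I l a := Finset.sum_comm
      _ = ∑ l, ∑ j, ∑ i, I i j * D l i j * I l a :=
          Finset.sum_congr rfl fun l _ => Finset.sum_comm
      _ = _ := Finset.sum_congr rfl fun l _ => Finset.sum_congr rfl fun j _ =>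
          Finset.sum_congr rfl fun i _ => by rw [hI i j]; ring
  rw [h3, h4, h5]
  simp only [h1, h2, Finset.sum_neg_distrib]
  ring

/-- The Laplacian in divergence form. -/
theorem coordLaplacian_eq {G : EuclideanSpace ℝ (Fin k) → Matrix (Fin k) (Fin k) ℝ}
    {f : EuclideanSpace ℝ (Fin k) → ℝ} {y : EuclideanSpace ℝ (Fin k)} (hsymm : (G y).IsSymm)
    (hG : ∀ i j, ContDiffAt ℝ 1 (fun z => G z i j) y) (hdet : IsUnit (G y).det)
    (hf : ContDiffAt ℝ 2 f y) :
    coordLaplacian G f y = ∑ i, partialDeriv i (coordGradient G f i) y +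
      (1 / 2) * ∑ i, coordGradient G f i y *
        (partialDeriv i (fun z => (G z).det) y / (G y).det) := by
  -- Since ½ ∂ᵢdet/det = ∂ᵢ log √det, the right-hand side is (√det)⁻¹ ∂ᵢ(√det ∇ⁱf) without square
  -- roots. The product rule for Gⁱʲ∂ⱼf produces the term ∂ᵢGⁱᵃ of the contracted Christoffel
  -- symbols.
  have hI : ∀ i j, DifferentiableAt ℝ (fun z => (G z)⁻¹ i j) y :=
    fun i j => (contDiffAt_matrix_inv hG hdet i j).differentiableAt one_ne_zero
  have hf' : ∀ j, DifferentiableAt ℝ (partialDeriv j f) y := fun j =>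
    (ContDiffAt.partialDeriv (n' := 1) hf (by norm_num) j).differentiableAt one_ne_zero
  have h1 : ∀ i, partialDeriv i (coordGradient G f i) y =
      ∑ j, ((G y)⁻¹ i j * partialDeriv i (partialDeriv j f) y +
        partialDeriv i (fun z => (G z)⁻¹ i j) y * partialDeriv j f y) := by
    intro i
    have h := fderiv_fun_sum (A := fun j z => (G z)⁻¹ i j * partialDeriv j f z) (u := Finset.univ)
      fun j _ => (hI i j).mul (hf' j)
    refine (congrArg (fun L => L (EuclideanSpace.single i (1 : ℝ))) h).trans ?_
    simp only [_root_.sum_apply]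
    refine Finset.sum_congr rfl fun j _ => ?_
    rw [fderiv_fun_mul (hI i j) (hf' j)]
    simp only [_root_.add_apply, _root_.smul_apply, smul_eq_mul,
      partialDeriv]
    ring
  have h2 : ∑ i, ∑ j, (G y)⁻¹ i j * ∑ a, christoffel G a i j y * partialDeriv a f y =
      ∑ a, (∑ i, ∑ j, (G y)⁻¹ i j * christoffel G a i j y) * partialDeriv a f y := by
    simp only [Finset.mul_sum, Finset.sum_mul]
    calc _ = ∑ i, ∑ a, ∑ j, (G y)⁻¹ i j * (christoffel G a i j y * partialDeriv a f y) :=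
          Finset.sum_congr rfl fun i _ => Finset.sum_comm
      _ = ∑ a, ∑ i, ∑ j, (G y)⁻¹ i j * (christoffel G a i j y * partialDeriv a f y) :=
          Finset.sum_comm
      _ = _ := by simp only [mul_assoc]
  have h3 : ∑ i, (∑ j, (G y)⁻¹ i j * partialDeriv j f y) *
        (partialDeriv i (fun z => (G z).det) y / (G y).det) =
      ∑ a, (∑ l, (G y)⁻¹ l a * (partialDeriv l (fun z => (G z).det) y / (G y).det)) *
        partialDeriv a f y := by
    simp only [Finset.sum_mul]
    rw [Finset.sum_comm]
    exact Finset.sum_congr rfl fun a _ => Finset.sum_congr rfl fun l _ => by ring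
  have h4 : ∑ i, ∑ j, partialDeriv i (fun z => (G z)⁻¹ i j) y * partialDeriv j f y =
      ∑ a, (∑ i, partialDeriv i (fun z => (G z)⁻¹ i a) y) * partialDeriv a f y := by
    simp only [Finset.sum_mul]
    exact Finset.sum_comm
  simp only [coordLaplacian, mul_sub, Finset.sum_sub_distrib, h1, Finset.sum_add_distrib]
  rw [h2, h4]
  simp only [sum_inv_mul_christoffel hsymm hG hdet, coordGradient]
  rw [h3]
  simp only [sub_mul, neg_mul, Finset.sum_sub_distrib, Finset.sum_neg_distrib, mul_assoc,
    ← Finset.mul_sum]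
  ring

/-- If the gradient of `f` is multiplied by `s` and the volume density by `s⁻¹`, then the Laplacian
of `f` is multiplied by `s`. -/
theorem coordLaplacian_of_gradient_eq
    {G G' : EuclideanSpace ℝ (Fin k) → Matrix (Fin k) (Fin k) ℝ}
    {f s : EuclideanSpace ℝ (Fin k) → ℝ} {y : EuclideanSpace ℝ (Fin k)}
    (hsymm : (G y).IsSymm) (hsymm' : (G' y).IsSymm)
    (hG : ∀ i j, ContDiffAt ℝ 1 (fun z => G z i j) y)
    (hG' : ∀ i j, ContDiffAt ℝ 1 (fun z => G' z i j) y)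
    (hdet : IsUnit (G y).det) (hdet' : IsUnit (G' y).det)
    (hf : ContDiffAt ℝ 2 f y) (hs : DifferentiableAt ℝ s y) (hs0 : s y ≠ 0)
    (hgrad : ∀ i, coordGradient G' f i =ᶠ[nhds y] fun z => s z * coordGradient G f i z)
    (hvol : (fun z => (G z).det) =ᶠ[nhds y] fun z => s z ^ 2 * (G' z).det) :
    coordLaplacian G' f y = s y * coordLaplacian G f y := by
  have hI : ∀ i j, DifferentiableAt ℝ (fun z => (G z)⁻¹ i j) y :=
    fun i j => (contDiffAt_matrix_inv hG hdet i j).differentiableAt one_ne_zero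
  have hf' : ∀ j, DifferentiableAt ℝ (partialDeriv j f) y := fun j =>
    (ContDiffAt.partialDeriv (n' := 1) hf (by norm_num) j).differentiableAt one_ne_zero
  have hW : ∀ i, DifferentiableAt ℝ (coordGradient G f i) y := fun i =>
    DifferentiableAt.fun_sum fun j _ => (hI i j).mul (hf' j)
  have hD' : DifferentiableAt ℝ (fun z => (G' z).det) y :=
    (contDiffAt_matrix_det hG').differentiableAt one_ne_zero
  have h1 : ∀ i, partialDeriv i (coordGradient G' f i) y =
      s y * partialDeriv i (coordGradient G f i) y + partialDeriv i s y * coordGradient G f i y := by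
    intro i
    rw [partialDeriv, (hgrad i).fderiv_eq, fderiv_fun_mul hs (hW i)]
    simp only [_root_.add_apply, _root_.smul_apply, smul_eq_mul,
      partialDeriv]
    ring
  -- Logarithmic derivative of det G = s² det G'. After the factor ½, its extra term 2 ∂ᵢs/s
  -- accounts exactly for the term ∂ᵢs ∇ⁱf in `h1`.
  have h2 : ∀ i, partialDeriv i (fun z => (G z).det) y / (G y).det =
      partialDeriv i (fun z => (G' z).det) y / (G' y).det + 2 * partialDeriv i s y / s y := by
    intro i
    have h : HasFDerivAt (fun z => (G z).det) _ y :=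
      ((hs.hasFDerivAt.pow 2).mul hD'.hasFDerivAt).congr_of_eventuallyEq hvol
    have h' := congrArg (fun L : EuclideanSpace ℝ (Fin k) →L[ℝ] ℝ =>
      L (EuclideanSpace.single i (1 : ℝ))) h.fderiv
    simp only [_root_.add_apply, _root_.smul_apply, smul_eq_mul] at h'
    have h0 : (G y).det = s y ^ 2 * (G' y).det := hvol.eq_of_nhds
    have hd0 := hdet'.ne_zero
    rw [h0]
    simp only [partialDeriv]
    rw [h']
    field_simp
    simp
    ring
  have h3 : ∀ i, coordGradient G' f i y = s y * coordGradient G f i y :=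
    fun i => (hgrad i).eq_of_nhds
  rw [coordLaplacian_eq hsymm hG hdet hf, coordLaplacian_eq hsymm' hG' hdet' hf]
  simp only [h1, h2, h3, Finset.mul_sum, mul_add, ← Finset.sum_add_distrib]
  refine Finset.sum_congr rfl fun i _ => ?_
  field_simp
  ring

end Laplacian

/-! ### Bilinear forms and differentials in charts -/

section Charts

open Matrix

variable {m : ℕ}
  {M : Type*} [TopologicalSpace M] [ChartedSpace (EuclideanSpace ℝ (Fin m)) M]

/-- The coordinate frame of the preferred chart at `x₀`, at the point with coordinates `y`. -/
def frame (x₀ : M) (y : EuclideanSpace ℝ (Fin m)) :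
    (Fin m → ℝ) →ₗ[ℝ] TangentSpace (𝓡 m) ((extChartAt (𝓡 m) x₀).symm y) :=
  (mfderiv 𝓘(ℝ, EuclideanSpace ℝ (Fin m)) (𝓡 m) (extChartAt (𝓡 m) x₀).symm y).toLinearMap ∘ₗ
    (WithLp.linearEquiv 2 ℝ (Fin m → ℝ)).symm.toLinearMap

theorem frame_single (x₀ : M) (i : Fin m) (y : EuclideanSpace ℝ (Fin m)) :
    frame x₀ y (Pi.single i 1) = coordVec x₀ i y := rfl

/-- The components of a field of bilinear forms in the preferred chart at `x₀`. -/
def tensorMatrix (B : ∀ x : M, TangentSpace (𝓡 m) x →L[ℝ] TangentSpace (𝓡 m) x →L[ℝ] ℝ) (x₀ : M)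
    (y : EuclideanSpace ℝ (Fin m)) : Matrix (Fin m) (Fin m) ℝ :=
  Matrix.of fun i j => B ((extChartAt (𝓡 m) x₀).symm y) (coordVec x₀ i y) (coordVec x₀ j y)

theorem bilin_frame (B : ∀ x : M, TangentSpace (𝓡 m) x →L[ℝ] TangentSpace (𝓡 m) x →L[ℝ] ℝ)
    (x₀ : M) (y : EuclideanSpace ℝ (Fin m)) (v w : Fin m → ℝ) :
    B ((extChartAt (𝓡 m) x₀).symm y) (frame x₀ y v) (frame x₀ y w) =
      v ⬝ᵥ tensorMatrix B x₀ y *ᵥ w := by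
  let β : (Fin m → ℝ) →ₗ[ℝ] (Fin m → ℝ) →ₗ[ℝ] ℝ :=
    LinearMap.mk₂ ℝ (fun v w => B ((extChartAt (𝓡 m) x₀).symm y) (frame x₀ y v) (frame x₀ y w))
      (by intros; rw [map_add, map_add]; rfl) (by intros; rw [map_smul, map_smul]; rfl)
      (by intros; rw [map_add, map_add]) (by intros; rw [map_smul, map_smul])
  have h : LinearMap.toMatrix₂' ℝ β = tensorMatrix B x₀ y := rfl
  rw [← h, ← toLinearMap₂'_apply', toLinearMap₂'_toMatrix']
  rfl

variable [IsManifold (𝓡 m) ∞ M]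

theorem frame_bijective (x₀ : M) {y : EuclideanSpace ℝ (Fin m)}
    (hy : y ∈ (extChartAt (𝓡 m) x₀).target) : Function.Bijective (frame x₀ y) := by
  have : IsManifold (𝓡 m) 1 M := IsManifold.of_le (n := ∞) (by norm_num)
  obtain ⟨e, he⟩ := isInvertible_mfderivWithin_extChartAt_symm (I := 𝓡 m) hy
  have he' : mfderiv 𝓘(ℝ, EuclideanSpace ℝ (Fin m)) (𝓡 m) (extChartAt (𝓡 m) x₀).symm y = e := by
    rw [he, ModelWithCorners.range_eq_univ, mfderivWithin_univ]
  have h : (frame x₀ y : (Fin m → ℝ) → _) = e ∘ (WithLp.linearEquiv 2 ℝ (Fin m → ℝ)).symm := by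
    unfold frame
    rw [he']
    rfl
  rw [h]
  exact e.bijective.comp (WithLp.linearEquiv 2 ℝ (Fin m → ℝ)).symm.bijective

theorem metricMatrix_isSymm (g : Metric m M) (x₀ : M) (y : EuclideanSpace ℝ (Fin m)) :
    (metricMatrix g x₀ y).IsSymm := by
  ext i j
  exact g.symm _ _ _

theorem inner_frame (g : Metric m M) (x₀ : M) (y : EuclideanSpace ℝ (Fin m)) (v w : Fin m → ℝ) :
    g.inner ((extChartAt (𝓡 m) x₀).symm y) (frame x₀ y v) (frame x₀ y w) =
      v ⬝ᵥ metricMatrix g x₀ y *ᵥ w :=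
  bilin_frame g.inner x₀ y v w

theorem metricMatrix_posDef (g : Metric m M) (x₀ : M) {y : EuclideanSpace ℝ (Fin m)}
    (hy : y ∈ (extChartAt (𝓡 m) x₀).target) : (metricMatrix g x₀ y).PosDef := by
  refine PosDef.of_dotProduct_mulVec_pos ?_ fun v hv => ?_
  · rw [IsHermitian, conjTranspose_eq_transpose_of_trivial]
    exact metricMatrix_isSymm g x₀ y
  · rw [star_trivial, ← inner_frame]
    refine g.pos _ _ fun h => hv ((frame_bijective x₀ hy).1 ?_)
    rw [h, map_zero]

/-- The tangent bundle trivialization at x₀ is inverted by the derivative of the inverse chart, so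
its frame is the coordinate frame. This links bundle smoothness to matrix entries. -/
theorem tensorMatrix_extChartAt
    (B : ∀ x : M, TangentSpace (𝓡 m) x →L[ℝ] TangentSpace (𝓡 m) x →L[ℝ] ℝ) (x₀ : M) {x : M}
    (hx : x ∈ (chartAt (EuclideanSpace ℝ (Fin m)) x₀).source) (i j : Fin m) :
    tensorMatrix B x₀ (extChartAt (𝓡 m) x₀ x) i j =
      B x ((trivializationAt (EuclideanSpace ℝ (Fin m)) (TangentSpace (𝓡 m)) x₀).symm x
          (EuclideanSpace.single i 1))
        ((trivializationAt (EuclideanSpace ℝ (Fin m)) (TangentSpace (𝓡 m)) x₀).symm x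
          (EuclideanSpace.single j 1)) := by
  have : IsManifold (𝓡 m) 1 M := IsManifold.of_le (n := ∞) (by norm_num)
  have h := TangentBundle.symmL_trivializationAt (𝕜 := ℝ) (I := 𝓡 m) hx
  rw [ModelWithCorners.range_eq_univ, mfderivWithin_univ] at h
  -- The inverse chart returns x only up to a propositional equality, so the base point is varied
  -- with the vectors fixed in the model space.
  have key : ∀ q : M, q = x → ∀ u v : EuclideanSpace ℝ (Fin m), B q u v = B x u v := by
    rintro _ rfl u v; rfl
  have hc : ∀ i : Fin m, (trivializationAt (EuclideanSpace ℝ (Fin m)) (TangentSpace (𝓡 m)) x₀).symm x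
      (EuclideanSpace.single i 1) = coordVec x₀ i (extChartAt (𝓡 m) x₀ x) := fun i =>
    (Trivialization.symmL_apply (R := ℝ) _ (by rwa [TangentBundle.trivializationAt_baseSet])
      _).symm.trans <| congrArg (fun L : EuclideanSpace ℝ (Fin m) →L[ℝ] EuclideanSpace ℝ (Fin m) =>
      L (EuclideanSpace.single i (1 : ℝ))) h
  rw [hc, hc]
  exact key _ ((extChartAt (𝓡 m) x₀).left_inv (by rwa [extChartAt_source])) _ _

/-- A field of bilinear forms is smooth if and only if its components in charts are. -/
theorem contMDiffAt_bilin_iff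
    (B : ∀ x : M, TangentSpace (𝓡 m) x →L[ℝ] TangentSpace (𝓡 m) x →L[ℝ] ℝ) (x₀ : M) :
    ContMDiffAt (𝓡 m) ((𝓡 m).prod 𝓘(ℝ, EuclideanSpace ℝ (Fin m) →L[ℝ]
        EuclideanSpace ℝ (Fin m) →L[ℝ] ℝ)) ∞
      (fun x => TotalSpace.mk' (EuclideanSpace ℝ (Fin m) →L[ℝ] EuclideanSpace ℝ (Fin m) →L[ℝ] ℝ)
        (E := fun x : M => TangentSpace (𝓡 m) x →L[ℝ] TangentSpace (𝓡 m) x →L[ℝ] ℝ) x (B x)) x₀ ↔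
    ∀ i j, ContDiffAt ℝ ∞ (fun y => tensorMatrix B x₀ y i j) (extChartAt (𝓡 m) x₀ x₀) := by
  have hsrc : ∀ᶠ x in nhds x₀, x ∈ (chartAt (EuclideanSpace ℝ (Fin m)) x₀).source :=
    (chartAt (EuclideanSpace ℝ (Fin m)) x₀).open_source.mem_nhds (mem_chart_source _ x₀)
  rw [contMDiffAt_hom_bundle]
  set F : M → EuclideanSpace ℝ (Fin m) →L[ℝ] EuclideanSpace ℝ (Fin m) →L[ℝ] ℝ := fun x =>
    ContinuousLinearMap.inCoordinates (EuclideanSpace ℝ (Fin m)) (TangentSpace (𝓡 m))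
      (EuclideanSpace ℝ (Fin m) →L[ℝ] ℝ) (fun x : M => TangentSpace (𝓡 m) x →L[ℝ] ℝ)
      x₀ x x₀ x (B x) with hF
  have hFB : ∀ x ∈ (chartAt (EuclideanSpace ℝ (Fin m)) x₀).source, ∀ i j,
      F x (EuclideanSpace.single i 1) (EuclideanSpace.single j 1) =
        tensorMatrix B x₀ (extChartAt (𝓡 m) x₀ x) i j := by
    intro x hx i j
    rw [tensorMatrix_extChartAt B x₀ hx, hF]
    have hx' : x ∈ (trivializationAt (EuclideanSpace ℝ (Fin m)) (TangentSpace (𝓡 m)) x₀).baseSet := by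
      rwa [TangentBundle.trivializationAt_baseSet]
    have h := inCoordinates_apply_eq₂ (𝕜 := ℝ) (x₀ := x₀) (x := x)
      (E₃ := fun _ : M => ℝ) (F₃ := ℝ) (ϕ := B x) (v := EuclideanSpace.single i (1 : ℝ))
      (w := EuclideanSpace.single j (1 : ℝ)) hx' hx' (Set.mem_univ _)
    refine h.trans ?_
    simp
  constructor
  · rintro ⟨-, h⟩ i j
    have h1 : ContMDiffAt (𝓡 m) 𝓘(ℝ, ℝ) ∞
        (fun x => F x (EuclideanSpace.single i 1) (EuclideanSpace.single j 1)) x₀ :=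
      (h.clm_apply contMDiffAt_const).clm_apply contMDiffAt_const
    have h2 : ContMDiffAt 𝓘(ℝ, EuclideanSpace ℝ (Fin m)) (𝓡 m) ∞ (extChartAt (𝓡 m) x₀).symm
        (extChartAt (𝓡 m) x₀ x₀) :=
      (contMDiffOn_extChartAt_symm x₀).contMDiffAt (extChartAt_target_mem_nhds x₀)
    rw [← contMDiffAt_iff_contDiffAt]
    have h3 := ContMDiffAt.comp_of_eq h1 h2 (extChartAt_to_inv x₀)
    refine h3.congr_of_eventuallyEq ?_
    filter_upwards [extChartAt_target_mem_nhds (I := 𝓡 m) x₀] with y hy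
    have hy' := (extChartAt (𝓡 m) x₀).map_target hy
    rw [extChartAt_source] at hy'
    rw [Function.comp_apply, hFB _ hy', (extChartAt (𝓡 m) x₀).right_inv hy]
  · intro h
    refine ⟨contMDiffAt_id, ?_⟩
    have h1 : ∀ i j, ContMDiffAt (𝓡 m) 𝓘(ℝ, ℝ) ∞
        (fun x => tensorMatrix B x₀ (extChartAt (𝓡 m) x₀ x) i j) x₀ := fun i j =>
      (h i j).contMDiffAt.comp x₀ contMDiffAt_extChartAt
    -- Expansion in the constant basis eⁱ ⊗ eʲ: smooth coefficients give a smooth form.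
    have h2 : F =ᶠ[nhds x₀] fun x => ∑ i, ∑ j, tensorMatrix B x₀ (extChartAt (𝓡 m) x₀ x) i j •
        ((EuclideanSpace.proj i : EuclideanSpace ℝ (Fin m) →L[ℝ] ℝ).smulRight
          (EuclideanSpace.proj j : EuclideanSpace ℝ (Fin m) →L[ℝ] ℝ)) := by
      filter_upwards [hsrc] with x hx
      ext v w
      have hv : ∀ v : EuclideanSpace ℝ (Fin m), v = ∑ i, v i • EuclideanSpace.single i (1 : ℝ) := by
        intro v
        ext l
        simp [Finset.sum_apply, Pi.single_apply]
      conv_lhs => rw [hv v, hv w]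
      simp only [map_sum, map_smul, _root_.sum_apply, _root_.smul_apply, hFB x hx, smul_eq_mul,
        Finset.mul_sum]
      rw [Finset.sum_comm]
      refine Finset.sum_congr rfl fun i _ => Finset.sum_congr rfl fun j _ => ?_
      change _ = _ * (v i * w j)
      ring
    refine ContMDiffAt.congr_of_eventuallyEq ?_ h2
    refine ContMDiffAt.sum fun i _ => ContMDiffAt.sum fun j _ => (h1 i j).smul contMDiffAt_const

end Charts

/-! ### Horizontal and vertical parts of a metric -/

section Projections

variable {m k : ℕ}
  {M : Type*} [TopologicalSpace M] [ChartedSpace (EuclideanSpace ℝ (Fin m)) M]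
  [IsManifold (𝓡 m) ∞ M]
  {N : Type*} [TopologicalSpace N] [ChartedSpace (EuclideanSpace ℝ (Fin k)) N]
  (g : Metric m M) (φ : M → N) (x : M)

theorem verticalProj_eq (v : TangentSpace (𝓡 m) x) :
    verticalProj (k := k) g φ x v = v - horizontalProj (k := k) g φ x v :=
  eq_sub_of_add_eq (Submodule.projection_add_projection_eq_self _ v)

theorem verticalProj_mem (v : TangentSpace (𝓡 m) x) :
    verticalProj (k := k) g φ x v ∈ vertical (k := k) φ x :=
  Submodule.projection_apply_mem _ v

theorem horizontalProj_mem (v : TangentSpace (𝓡 m) x) :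
    horizontalProj (k := k) g φ x v ∈ horizontal (k := k) g φ x :=
  Submodule.projection_apply_mem _ v

theorem horizontalProj_of_mem {v : TangentSpace (𝓡 m) x}
    (hv : v ∈ horizontal (k := k) g φ x) : horizontalProj (k := k) g φ x v = v :=
  (Submodule.projection_eq_self_iff _ v).2 hv

theorem horizontalProj_eq_of_mem {u v : TangentSpace (𝓡 m) x}
    (hu : u ∈ horizontal (k := k) g φ x) (hv : v - u ∈ vertical (k := k) φ x) :
    horizontalProj (k := k) g φ x v = u := by
  have h1 : horizontalProj (k := k) g φ x (v - u) = 0 :=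
    (Submodule.projection_apply_eq_zero_iff _).2 hv
  rw [map_sub, sub_eq_zero] at h1
  rw [h1, horizontalProj_of_mem (k := k) g φ x hu]

theorem inner_vertical_horizontal {u v : TangentSpace (𝓡 m) x}
    (hu : u ∈ vertical (k := k) φ x) (hv : v ∈ horizontal (k := k) g φ x) :
    g.inner x u v = 0 := hv u hu

theorem inner_horizontal_vertical {u v : TangentSpace (𝓡 m) x}
    (hu : u ∈ horizontal (k := k) g φ x) (hv : v ∈ vertical (k := k) φ x) :
    g.inner x u v = 0 := by
  rw [g.symm]
  exact inner_vertical_horizontal (k := k) g φ x hv hu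

/-- The second projection may be dropped because horizontal and vertical vectors are orthogonal;
this exhibits g^ℋ as g composed with one linear map. -/
theorem horizontalPart_eq (v w : TangentSpace (𝓡 m) x) :
    horizontalPart (k := k) g φ x v w = g.inner x (horizontalProj (k := k) g φ x v) w := by
  have h := inner_horizontal_vertical (k := k) g φ x (horizontalProj_mem (k := k) g φ x v)
    (verticalProj_mem (k := k) g φ x w)
  rw [verticalProj_eq, map_sub, sub_eq_zero] at h
  rw [horizontalPart, h]

theorem horizontalPart_add_verticalPart (v w : TangentSpace (𝓡 m) x) :
    horizontalPart (k := k) g φ x v w + verticalPart (k := k) g φ x v w = g.inner x v w := by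
  have h := inner_vertical_horizontal (k := k) g φ x (verticalProj_mem (k := k) g φ x v)
    (horizontalProj_mem (k := k) g φ x w)
  have h' : verticalPart (k := k) g φ x v w = g.inner x (verticalProj (k := k) g φ x v) w := by
    rw [verticalPart, verticalProj_eq (k := k) g φ x w, map_sub, h, sub_zero]
  rw [horizontalPart_eq, h', verticalProj_eq, map_sub, _root_.sub_apply, add_sub_cancel]

theorem horizontalPart_self_nonneg (v : TangentSpace (𝓡 m) x) :
    0 ≤ horizontalPart (k := k) g φ x v v := by
  by_cases h : horizontalProj (k := k) g φ x v = 0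
  · rw [horizontalPart, h, map_zero]
  · exact (g.pos x _ h).le

theorem verticalPart_self_nonneg (v : TangentSpace (𝓡 m) x) :
    0 ≤ verticalPart (k := k) g φ x v v := by
  by_cases h : verticalProj (k := k) g φ x v = 0
  · rw [verticalPart, h, map_zero]
  · exact (g.pos x _ h).le

end Projections

/-! ### The Jacobian matrix of a submersion -/

section Jacobian

open Matrix

variable {m k : ℕ}
  {M : Type*} [TopologicalSpace M] [ChartedSpace (EuclideanSpace ℝ (Fin m)) M]
  {N : Type*} [TopologicalSpace N] [ChartedSpace (EuclideanSpace ℝ (Fin k)) N]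

/-- The Jacobian matrix of `φ` in the preferred charts at `x₀` and `φ x₀`. -/
def jacobian (φ : M → N) (x₀ : M) (y : EuclideanSpace ℝ (Fin m)) : Matrix (Fin k) (Fin m) ℝ :=
  Matrix.of fun c j => partialDeriv j (localComp φ x₀ c) y

/-- Gradients of the components of φ are the columns of G⁻¹Aᵀ, which lets the matrix identities
apply to them. -/
theorem coordGradient_localComp (G : EuclideanSpace ℝ (Fin m) → Matrix (Fin m) (Fin m) ℝ)
    (φ : M → N) (x₀ : M) (c : Fin k) (i : Fin m) (y : EuclideanSpace ℝ (Fin m)) :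
    coordGradient G (localComp φ x₀ c) i y = ((G y)⁻¹ * (jacobian (k := k) φ x₀ y)ᵀ) i c := rfl

variable {φ : M → N}

theorem contDiffAt_localComp (hφ : ContMDiff (𝓡 m) (𝓡 k) ∞ φ) (x₀ : M) (c : Fin k) :
    ContDiffAt ℝ ∞ (localComp φ x₀ c) (extChartAt (𝓡 m) x₀ x₀) := by
  have h := (contMDiffAt_iff.1 (hφ x₀)).2
  rw [ModelWithCorners.range_eq_univ, contDiffWithinAt_univ] at h
  exact (contDiffAt_euclidean.1 h) c

theorem contDiffAt_jacobian (hφ : ContMDiff (𝓡 m) (𝓡 k) ∞ φ) (x₀ : M) (c : Fin k) (j : Fin m) :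
    ContDiffAt ℝ ∞ (fun y => jacobian φ x₀ y c j) (extChartAt (𝓡 m) x₀ x₀) :=
  ContDiffAt.partialDeriv (contDiffAt_localComp hφ x₀ c) (by norm_num) j

/-- The chart formulas are going to be differentiated, so they are needed on a neighbourhood and not
only at the centre. -/
theorem eventually_mem_charts (hφ : Continuous φ) (x₀ : M) :
    ∀ᶠ y in nhds (extChartAt (𝓡 m) x₀ x₀), y ∈ (extChartAt (𝓡 m) x₀).target ∧
      φ ((extChartAt (𝓡 m) x₀).symm y) ∈ (extChartAt (𝓡 k) (φ x₀)).source := by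
  have h : ContinuousAt (fun y => φ ((extChartAt (𝓡 m) x₀).symm y)) (extChartAt (𝓡 m) x₀ x₀) :=
    hφ.continuousAt.comp (continuousAt_extChartAt_symm x₀)
  refine Filter.Eventually.and (extChartAt_target_mem_nhds x₀) (h.eventually_mem ?_)
  rw [extChartAt_to_inv]
  exact extChartAt_source_mem_nhds (φ x₀)

variable [IsManifold (𝓡 m) ∞ M] [IsManifold (𝓡 k) ∞ N]

/-- The chain rule for chart ∘ φ ∘ inverse chart. The chart derivatives are isomorphisms, so the
kernel and surjectivity of dφ pass to the Jacobian matrix. -/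
theorem jacobian_mulVec (hφ : ContMDiff (𝓡 m) (𝓡 k) ∞ φ) (x₀ : M)
    {y : EuclideanSpace ℝ (Fin m)} (hy : y ∈ (extChartAt (𝓡 m) x₀).target)
    (hy' : φ ((extChartAt (𝓡 m) x₀).symm y) ∈ (extChartAt (𝓡 k) (φ x₀)).source)
    (v : Fin m → ℝ) :
    (WithLp.toLp 2 (jacobian φ x₀ y *ᵥ v) : EuclideanSpace ℝ (Fin k)) =
      mfderiv (𝓡 k) 𝓘(ℝ, EuclideanSpace ℝ (Fin k)) (extChartAt (𝓡 k) (φ x₀))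
        (φ ((extChartAt (𝓡 m) x₀).symm y))
        (differential φ ((extChartAt (𝓡 m) x₀).symm y) (frame x₀ y v)) := by
  have : IsManifold (𝓡 m) 1 M := IsManifold.of_le (n := ∞) (by norm_num)
  have : IsManifold (𝓡 k) 1 N := IsManifold.of_le (n := ∞) (by norm_num)
  have h1 : MDifferentiableAt 𝓘(ℝ, EuclideanSpace ℝ (Fin m)) (𝓡 m) (extChartAt (𝓡 m) x₀).symm y := by
    have h := mdifferentiableWithinAt_extChartAt_symm (I := 𝓡 m) hy
    rwa [ModelWithCorners.range_eq_univ, mdifferentiableWithinAt_univ] at h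
  have h2 : MDifferentiableAt (𝓡 m) (𝓡 k) φ ((extChartAt (𝓡 m) x₀).symm y) :=
    hφ.mdifferentiable (by norm_num) _
  have h3 : MDifferentiableAt (𝓡 k) 𝓘(ℝ, EuclideanSpace ℝ (Fin k)) (extChartAt (𝓡 k) (φ x₀))
      (φ ((extChartAt (𝓡 m) x₀).symm y)) :=
    mdifferentiableAt_extChartAt (by rwa [extChartAt_source] at hy')
  set F : EuclideanSpace ℝ (Fin m) → EuclideanSpace ℝ (Fin k) :=
    writtenInExtChartAt (𝓡 m) (𝓡 k) x₀ φ with hF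
  have h4 : MDifferentiableAt 𝓘(ℝ, EuclideanSpace ℝ (Fin m)) 𝓘(ℝ, EuclideanSpace ℝ (Fin k)) F y :=
    (h3.comp y (h2.comp y h1))
  have h5 : fderiv ℝ F y = (mfderiv (𝓡 k) 𝓘(ℝ, EuclideanSpace ℝ (Fin k)) (extChartAt (𝓡 k) (φ x₀))
        (φ ((extChartAt (𝓡 m) x₀).symm y))).comp
      ((mfderiv (𝓡 m) (𝓡 k) φ ((extChartAt (𝓡 m) x₀).symm y)).comp
        (mfderiv 𝓘(ℝ, EuclideanSpace ℝ (Fin m)) (𝓡 m) (extChartAt (𝓡 m) x₀).symm y)) := by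
    rw [← mfderiv_eq_fderiv, ← mfderiv_comp y h2 h1]
    exact mfderiv_comp y h3 (h2.comp y h1)
  have h6 : DifferentiableAt ℝ F y := mdifferentiableAt_iff_differentiableAt.1 h4
  have h7 : ∀ c j, jacobian φ x₀ y c j = fderiv ℝ F y (EuclideanSpace.single j 1) c := by
    intro c j
    have h := ((EuclideanSpace.proj c : EuclideanSpace ℝ (Fin k) →L[ℝ] ℝ).hasFDerivAt.comp y
      h6.hasFDerivAt).fderiv
    exact congrArg (fun L : EuclideanSpace ℝ (Fin m) →L[ℝ] ℝ => L (EuclideanSpace.single j 1)) h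
  have h8 : (WithLp.toLp 2 (jacobian φ x₀ y *ᵥ v) : EuclideanSpace ℝ (Fin k)) =
      fderiv ℝ F y (WithLp.toLp 2 v) := by
    have hv : (WithLp.toLp 2 v : EuclideanSpace ℝ (Fin m)) =
        ∑ j, v j • EuclideanSpace.single j (1 : ℝ) := by
      ext l
      simp [Finset.sum_apply, Pi.single_apply]
    ext c
    rw [hv]
    simp only [map_sum, map_smul, mulVec, dotProduct, h7, WithLp.ofLp_sum, WithLp.ofLp_smul,
      Finset.sum_apply, Pi.smul_apply, smul_eq_mul]
    exact Finset.sum_congr rfl fun j _ => mul_comm _ _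
  rw [h8, h5]
  rfl

theorem jacobian_mulVec_eq_zero_iff (hφ : ContMDiff (𝓡 m) (𝓡 k) ∞ φ) (x₀ : M)
    {y : EuclideanSpace ℝ (Fin m)} (hy : y ∈ (extChartAt (𝓡 m) x₀).target)
    (hy' : φ ((extChartAt (𝓡 m) x₀).symm y) ∈ (extChartAt (𝓡 k) (φ x₀)).source)
    (v : Fin m → ℝ) :
    jacobian (k := k) φ x₀ y *ᵥ v = 0 ↔
      frame x₀ y v ∈ vertical (k := k) φ ((extChartAt (𝓡 m) x₀).symm y) := by
  have : IsManifold (𝓡 k) 1 N := IsManifold.of_le (n := ∞) (by norm_num)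
  obtain ⟨e, he⟩ := isInvertible_mfderiv_extChartAt (I := 𝓡 k) hy'
  have h := jacobian_mulVec (k := k) hφ x₀ hy hy' v
  rw [← he] at h
  rw [vertical, LinearMap.mem_ker]
  constructor
  · intro h0
    rw [h0, WithLp.toLp_zero] at h
    exact e.map_eq_zero_iff.1 h.symm
  · intro h0
    rw [h0] at h
    exact (WithLp.toLp_injective 2) (h.trans (map_zero e))

theorem jacobian_mulVec_surjective (hφ : IsSubmersion m k φ) (x₀ : M)
    {y : EuclideanSpace ℝ (Fin m)} (hy : y ∈ (extChartAt (𝓡 m) x₀).target)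
    (hy' : φ ((extChartAt (𝓡 m) x₀).symm y) ∈ (extChartAt (𝓡 k) (φ x₀)).source) :
    Function.Surjective (jacobian (k := k) φ x₀ y).mulVec := by
  have : IsManifold (𝓡 k) 1 N := IsManifold.of_le (n := ∞) (by norm_num)
  obtain ⟨e, he⟩ := isInvertible_mfderiv_extChartAt (I := 𝓡 k) hy'
  intro w
  obtain ⟨u, hu⟩ := hφ.2 _ (e.symm (WithLp.toLp 2 w : EuclideanSpace ℝ (Fin k)))
  obtain ⟨v, rfl⟩ := (frame_bijective x₀ hy).2 u
  refine ⟨v, WithLp.toLp_injective 2 ((jacobian_mulVec (k := k) hφ.1 x₀ hy hy' v).trans ?_)⟩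
  rw [← he]
  exact (congrArg e hu).trans (e.apply_symm_apply _)

/-- In coordinates the horizontal projection is P = `orthProj`: GP has the left factor Aᵀ, so Pw is
orthogonal to ker A, and AP = A puts w - Pw in ker A. -/
theorem horizontalPart_frame (g : Metric m M) (hφ : IsSubmersion m k φ) (x₀ : M)
    {y : EuclideanSpace ℝ (Fin m)} (hy : y ∈ (extChartAt (𝓡 m) x₀).target)
    (hy' : φ ((extChartAt (𝓡 m) x₀).symm y) ∈ (extChartAt (𝓡 k) (φ x₀)).source)
    (v w : Fin m → ℝ) :
    horizontalPart (k := k) g φ ((extChartAt (𝓡 m) x₀).symm y) (frame x₀ y v) (frame x₀ y w) =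
      v ⬝ᵥ horizontalGram (metricMatrix g x₀ y) (jacobian (k := k) φ x₀ y) *ᵥ w := by
  have hG := metricMatrix_posDef g x₀ hy
  have hA := jacobian_mulVec_surjective (k := k) hφ x₀ hy hy'
  have hP : horizontalProj (k := k) g φ ((extChartAt (𝓡 m) x₀).symm y) (frame x₀ y w) =
      frame x₀ y (orthProj (metricMatrix g x₀ y) (jacobian (k := k) φ x₀ y) *ᵥ w) := by
    refine horizontalProj_eq_of_mem (k := k) _ _ _ ?_ ?_
    · intro u hu
      obtain ⟨u, rfl⟩ := (frame_bijective x₀ hy).2 u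
      have hu' := (jacobian_mulVec_eq_zero_iff (k := k) hφ.1 x₀ hy hy' u).2 hu
      change g.inner _ _ _ = 0
      rw [inner_frame, mulVec_mulVec, mul_orthProj_left hG, horizontalGram, Matrix.mul_assoc,
        ← mulVec_mulVec, dotProduct_mulVec, vecMul_transpose, hu', zero_dotProduct]
    · rw [← map_sub, ← jacobian_mulVec_eq_zero_iff (k := k) hφ.1 x₀ hy hy', mulVec_sub, mulVec_mulVec,
        mul_orthProj hG hA, sub_self]
  have hsymm : horizontalPart (k := k) g φ ((extChartAt (𝓡 m) x₀).symm y) (frame x₀ y v)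
      (frame x₀ y w) = g.inner _ (frame x₀ y v)
        (horizontalProj (k := k) g φ ((extChartAt (𝓡 m) x₀).symm y) (frame x₀ y w)) := by
    rw [g.symm, ← horizontalPart_eq, horizontalPart, horizontalPart, g.symm]
  rw [hsymm, hP, inner_frame, mulVec_mulVec, mul_orthProj_left hG]

end Jacobian

/-! ### Biconformal changes of a metric -/

section Biconformal

open Matrix

variable {m k : ℕ}
  {M : Type*} [TopologicalSpace M] [ChartedSpace (EuclideanSpace ℝ (Fin m)) M]
  [IsManifold (𝓡 m) ∞ M]
  {N : Type*} [TopologicalSpace N] [ChartedSpace (EuclideanSpace ℝ (Fin k)) N]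
  {φ : M → N} {a t : M → ℝ}

instance (x : M) : T2Space (TangentSpace (𝓡 m) x) :=
  inferInstanceAs (T2Space (EuclideanSpace ℝ (Fin m)))

/-- The horizontal part of a metric, as a continuous bilinear form. -/
def horizontalForm (g : Metric m M) (φ : M → N) (x : M) :
    TangentSpace (𝓡 m) x →L[ℝ] TangentSpace (𝓡 m) x →L[ℝ] ℝ :=
  (g.inner x).comp (LinearMap.toContinuousLinearMap (horizontalProj (k := k) g φ x))

theorem horizontalForm_apply (g : Metric m M) (φ : M → N) (x : M) (v w : TangentSpace (𝓡 m) x) :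
    horizontalForm (k := k) g φ x v w = horizontalPart (k := k) g φ x v w := by
  rw [horizontalPart_eq]
  rfl

/-- The bilinear form `a g^ℋ + t g^𝒱`. -/
def biconformalForm (a t : M → ℝ) (g : Metric m M) (φ : M → N) (x : M) :
    TangentSpace (𝓡 m) x →L[ℝ] TangentSpace (𝓡 m) x →L[ℝ] ℝ :=
  a x • horizontalForm (k := k) g φ x + t x • (g.inner x - horizontalForm (k := k) g φ x)

theorem biconformalForm_apply (g : Metric m M) (x : M) (v w : TangentSpace (𝓡 m) x) :
    biconformalForm (k := k) a t g φ x v w =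
      a x * horizontalPart (k := k) g φ x v w + t x * verticalPart (k := k) g φ x v w := by
  have h : biconformalForm (k := k) a t g φ x v w =
      a x * horizontalForm (k := k) g φ x v w +
        t x * (g.inner x v w - horizontalForm (k := k) g φ x v w) := rfl
  rw [h, horizontalForm_apply, ← horizontalPart_add_verticalPart (k := k) g φ x v w,
    add_sub_cancel_left]

/-- This lower bound yields both positivity of the new form and boundedness of its unit balls. -/
theorem min_mul_inner_le_biconformalForm (g : Metric m M) (x : M) (v : TangentSpace (𝓡 m) x) :
    min (a x) (t x) * g.inner x v v ≤ biconformalForm (k := k) a t g φ x v v := by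
  rw [biconformalForm_apply, ← horizontalPart_add_verticalPart (k := k) g φ x v v, mul_add]
  exact add_le_add
    (mul_le_mul_of_nonneg_right (min_le_left _ _) (horizontalPart_self_nonneg (k := k) g φ x v))
    (mul_le_mul_of_nonneg_right (min_le_right _ _) (verticalPart_self_nonneg (k := k) g φ x v))

variable [IsManifold (𝓡 k) ∞ N]

theorem tensorMatrix_biconformalForm (g : Metric m M) (hφ : IsSubmersion m k φ) (x₀ : M)
    {y : EuclideanSpace ℝ (Fin m)} (hy : y ∈ (extChartAt (𝓡 m) x₀).target)
    (hy' : φ ((extChartAt (𝓡 m) x₀).symm y) ∈ (extChartAt (𝓡 k) (φ x₀)).source) :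
    tensorMatrix (biconformalForm (k := k) a t g φ) x₀ y =
      biconformalGram (a ((extChartAt (𝓡 m) x₀).symm y)) (t ((extChartAt (𝓡 m) x₀).symm y))
        (metricMatrix g x₀ y) (jacobian (k := k) φ x₀ y) := by
  ext i j
  have h := horizontalPart_frame (k := k) g hφ x₀ hy hy' (Pi.single i 1) (Pi.single j 1)
  rw [frame_single, frame_single, mulVec_single_one, single_one_dotProduct, col_apply,
    ← horizontalForm_apply] at h
  change a _ * horizontalForm (k := k) g φ _ (coordVec x₀ i y) (coordVec x₀ j y) +
    t _ * (g.inner _ (coordVec x₀ i y) (coordVec x₀ j y) -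
      horizontalForm (k := k) g φ _ (coordVec x₀ i y) (coordVec x₀ j y)) = _
  rw [h]
  rfl

theorem contDiffAt_comp_extChartAt_symm {f : M → ℝ} (hf : ContMDiff (𝓡 m) 𝓘(ℝ, ℝ) ∞ f) (x₀ : M) :
    ContDiffAt ℝ ∞ (fun y => f ((extChartAt (𝓡 m) x₀).symm y)) (extChartAt (𝓡 m) x₀ x₀) := by
  rw [← contMDiffAt_iff_contDiffAt]
  exact (hf _).comp _
    ((contMDiffOn_extChartAt_symm x₀).contMDiffAt (extChartAt_target_mem_nhds x₀))

theorem contDiffAt_metricMatrix (g : Metric m M) (x₀ : M) (i j : Fin m) :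
    ContDiffAt ℝ ∞ (fun y => metricMatrix g x₀ y i j) (extChartAt (𝓡 m) x₀ x₀) :=
  (contMDiffAt_bilin_iff g.inner x₀).1 (g.contMDiff x₀) i j

/-- In charts the entries are built from those of G and A by products and inverses, and the inverted
matrices G and A G⁻¹ Aᵀ are nonsingular. -/
theorem contMDiff_biconformalForm (g : Metric m M) (hφ : IsSubmersion m k φ)
    (ha : ContMDiff (𝓡 m) 𝓘(ℝ, ℝ) ∞ a) (ht : ContMDiff (𝓡 m) 𝓘(ℝ, ℝ) ∞ t) :
    ContMDiff (𝓡 m) ((𝓡 m).prod 𝓘(ℝ, EuclideanSpace ℝ (Fin m) →L[ℝ]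
        EuclideanSpace ℝ (Fin m) →L[ℝ] ℝ)) ∞
      (fun x => TotalSpace.mk' (EuclideanSpace ℝ (Fin m) →L[ℝ] EuclideanSpace ℝ (Fin m) →L[ℝ] ℝ)
        (E := fun x : M => TangentSpace (𝓡 m) x →L[ℝ] TangentSpace (𝓡 m) x →L[ℝ] ℝ) x
        (biconformalForm (k := k) a t g φ x)) := by
  intro x₀
  rw [contMDiffAt_bilin_iff]
  intro i j
  have hev := eventually_mem_charts (m := m) (k := k) hφ.1.continuous x₀
  have hG := metricMatrix_posDef g x₀ hev.self_of_nhds.1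
  have hA := jacobian_mulVec_surjective (k := k) hφ x₀ hev.self_of_nhds.1 hev.self_of_nhds.2
  have h1 := contDiffAt_metricMatrix g x₀
  have h2 := contDiffAt_jacobian (k := k) hφ.1 x₀
  have h2' : ∀ j c, ContDiffAt ℝ ∞ (fun y => (jacobian (k := k) φ x₀ y)ᵀ j c)
    (extChartAt (𝓡 m) x₀ x₀) := fun j c => h2 c j
  have h3 := contDiffAt_matrix_inv
    (contDiffAt_matrix_mul (contDiffAt_matrix_mul h2
      (contDiffAt_matrix_inv h1 (isUnit_det_of_posDef hG))) h2')
    (isUnit_det_mul_inv_mul_transpose hG hA)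
  have h4 : ContDiffAt ℝ ∞ (fun y => horizontalGram (metricMatrix g x₀ y)
      (jacobian (k := k) φ x₀ y) i j) (extChartAt (𝓡 m) x₀ x₀) :=
    contDiffAt_matrix_mul (contDiffAt_matrix_mul h2' h3) h2 i j
  refine ContDiffAt.congr_of_eventuallyEq (((contDiffAt_comp_extChartAt_symm ha x₀).mul h4).add
    ((contDiffAt_comp_extChartAt_symm ht x₀).mul ((h1 i j).sub h4))) ?_
  filter_upwards [hev] with y hy
  rw [tensorMatrix_biconformalForm g hφ x₀ hy.1 hy.2]
  rfl

/-- The metric `a g^ℋ + t g^𝒱`. -/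
def biconformalMetric (g : Metric m M) (hφ : IsSubmersion m k φ)
    (ha : ContMDiff (𝓡 m) 𝓘(ℝ, ℝ) ∞ a) (ht : ContMDiff (𝓡 m) 𝓘(ℝ, ℝ) ∞ t)
    (ha0 : ∀ x, 0 < a x) (ht0 : ∀ x, 0 < t x) : Metric m M where
  inner := biconformalForm (k := k) a t g φ
  symm x v w := by
    simp only [biconformalForm_apply, horizontalPart, verticalPart]
    rw [g.symm, g.symm x (verticalProj (k := k) g φ x v)]
  pos x v hv :=
    (mul_pos (lt_min (ha0 x) (ht0 x)) (g.pos x v hv)).trans_le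
      (min_mul_inner_le_biconformalForm (k := k) g x v)
  isVonNBounded x := by
    set c := min (a x) (t x) with hc
    have hc0 : 0 < c := lt_min (ha0 x) (ht0 x)
    have hr : 0 < Real.sqrt c := Real.sqrt_pos.2 hc0
    -- If c·g(v, v) < 1 then √c·v lies in the g-unit ball, so the new unit ball is inside the image
    -- of the old one under (√c)⁻¹.
    refine ((g.isVonNBounded x).image ((Real.sqrt c)⁻¹ •
      ContinuousLinearMap.id ℝ (TangentSpace (𝓡 m) x))).subset fun v hv => ?_
    refine ⟨Real.sqrt c • v, ?_, ?_⟩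
    · change g.inner x (Real.sqrt c • v) (Real.sqrt c • v) < 1
      have h : g.inner x (Real.sqrt c • v) (Real.sqrt c • v) = c * g.inner x v v := by
        rw [map_smul, map_smul, _root_.smul_apply, smul_eq_mul, smul_eq_mul, ← mul_assoc,
          Real.mul_self_sqrt hc0.le]
      rw [h]
      exact (min_mul_inner_le_biconformalForm (k := k) g x v).trans_lt hv
    · change (Real.sqrt c)⁻¹ • Real.sqrt c • v = v
      rw [smul_smul, inv_mul_cancel₀ hr.ne', one_smul]
  contMDiff := contMDiff_biconformalForm g hφ ha ht

end Biconformal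

/-! ### The tension field and biconformal changes -/

section TensionChange

open Matrix

variable {m k : ℕ}
  {M : Type*} [TopologicalSpace M] [ChartedSpace (EuclideanSpace ℝ (Fin m)) M]
  [IsManifold (𝓡 m) ∞ M]
  {N : Type*} [TopologicalSpace N] [ChartedSpace (EuclideanSpace ℝ (Fin k)) N]
  [IsManifold (𝓡 k) ∞ N] {φ : M → N} {a t : M → ℝ}

/-- The components of the tension field, in terms of the Laplacians and gradients of the components
of `φ`. -/
def tensionComp (g : Metric m M) (h : Metric k N) (φ : M → N) (x : M) (c : Fin k) : ℝ :=
  coordLaplacian (metricMatrix g x) (localComp φ x c) (extChartAt (𝓡 m) x x) +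
    ∑ p, ∑ q, ∑ i, christoffel (metricMatrix h (φ x)) c p q (extChartAt (𝓡 k) (φ x) (φ x)) *
      partialDeriv i (localComp φ x p) (extChartAt (𝓡 m) x x) *
      coordGradient (metricMatrix g x) (localComp φ x q) i (extChartAt (𝓡 m) x x)

theorem tensionField_eq (g : Metric m M) (h : Metric k N) (φ : M → N) (x : M) :
    tensionField g h φ x =
      (WithLp.toLp 2 (tensionComp g h φ x) : EuclideanSpace ℝ (Fin k)) := by
  refine congrArg (WithLp.toLp 2) (funext fun c => ?_)
  simp only [tensionComp, coordLaplacian, mul_add, Finset.sum_add_distrib]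
  congr 1
  simp only [coordGradient, Finset.mul_sum]
  calc _ = ∑ i, ∑ p, ∑ q, ∑ j, (metricMatrix g x (extChartAt (𝓡 m) x x))⁻¹ i j *
          (christoffel (metricMatrix h (φ x)) c p q (extChartAt (𝓡 k) (φ x) (φ x))
          * partialDeriv i (localComp φ x p) (extChartAt (𝓡 m) x x)
          * partialDeriv j (localComp φ x q) (extChartAt (𝓡 m) x x)) :=
        Finset.sum_congr rfl fun i _ => by
          rw [Finset.sum_comm]
          exact Finset.sum_congr rfl fun p _ => Finset.sum_comm
    _ = ∑ p, ∑ q, ∑ i, ∑ j, (metricMatrix g x (extChartAt (𝓡 m) x x))⁻¹ i j *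
          (christoffel (metricMatrix h (φ x)) c p q (extChartAt (𝓡 k) (φ x) (φ x))
          * partialDeriv i (localComp φ x p) (extChartAt (𝓡 m) x x)
          * partialDeriv j (localComp φ x q) (extChartAt (𝓡 m) x x)) := by
        rw [Finset.sum_comm]
        exact Finset.sum_congr rfl fun p _ => Finset.sum_comm
    _ = _ := Finset.sum_congr rfl fun p _ => Finset.sum_congr rfl fun q _ =>
        Finset.sum_congr rfl fun i _ => Finset.sum_congr rfl fun j _ => by ring

/-- If the horizontal and vertical scalings `a` and `t` balance, then a biconformal change of metric
multiplies the tension field by `a⁻¹`. -/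
theorem tensionField_biconformalMetric (g : Metric m M) (h : Metric k N) (hφ : IsSubmersion m k φ)
    (ha : ContMDiff (𝓡 m) 𝓘(ℝ, ℝ) ∞ a) (ht : ContMDiff (𝓡 m) 𝓘(ℝ, ℝ) ∞ t)
    (ha0 : ∀ x, 0 < a x) (ht0 : ∀ x, 0 < t x) (hat : ∀ x, t x ^ m * (a x / t x) ^ k = a x ^ 2)
    (x : M) :
    tensionField (biconformalMetric g hφ ha ht ha0 ht0) h φ x =
      (a x)⁻¹ • tensionField g h φ x := by
  set g' := biconformalMetric g hφ ha ht ha0 ht0 with hg'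
  set y₀ := extChartAt (𝓡 m) x x with hy₀
  have hev := eventually_mem_charts (m := m) (k := k) hφ.1.continuous x
  have hG' : ∀ᶠ y in nhds y₀, metricMatrix g' x y =
      biconformalGram (a ((extChartAt (𝓡 m) x).symm y)) (t ((extChartAt (𝓡 m) x).symm y))
        (metricMatrix g x y) (jacobian (k := k) φ x y) := by
    filter_upwards [hev] with y hy
    exact tensorMatrix_biconformalForm g hφ x hy.1 hy.2
  set s : EuclideanSpace ℝ (Fin m) → ℝ := fun y => (a ((extChartAt (𝓡 m) x).symm y))⁻¹ with hs
  have hsx : s y₀ = (a x)⁻¹ := by rw [hs, hy₀]; simp only [extChartAt_to_inv]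
  have hgrad : ∀ (c : Fin k) i, coordGradient (metricMatrix g' x) (localComp φ x c) i =ᶠ[nhds y₀]
      fun z => s z * coordGradient (metricMatrix g x) (localComp φ x c) i z := by
    intro c i
    filter_upwards [hev, hG'] with y hy hGy
    rw [coordGradient_localComp, coordGradient_localComp, hGy, biconformalGram_inv_mul_transpose
      (metricMatrix_posDef g x hy.1) (jacobian_mulVec_surjective (k := k) hφ x hy.1 hy.2)
      (ha0 _).ne' (ht0 _).ne']
    rfl
  -- The balance hypothesis reduces the determinant factor to a², and s = a⁻¹.
  have hvol : (fun z => (metricMatrix g x z).det) =ᶠ[nhds y₀]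
      fun z => s z ^ 2 * (metricMatrix g' x z).det := by
    filter_upwards [hev, hG'] with y hy hGy
    rw [hGy, det_biconformalGram (metricMatrix_posDef g x hy.1)
      (jacobian_mulVec_surjective (k := k) hφ x hy.1 hy.2) _ (ht0 _).ne', Fintype.card_fin,
      Fintype.card_fin, hat, hs, inv_pow, inv_mul_cancel_left₀ (pow_ne_zero 2 (ha0 _).ne')]
  have hlap : ∀ c : Fin k, coordLaplacian (metricMatrix g' x) (localComp φ x c) y₀ =
      s y₀ * coordLaplacian (metricMatrix g x) (localComp φ x c) y₀ := by
    intro c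
    refine coordLaplacian_of_gradient_eq (metricMatrix_isSymm g x _) (metricMatrix_isSymm g' x _)
      (fun i j => (contDiffAt_metricMatrix g x i j).of_le (by norm_num))
      (fun i j => (contDiffAt_metricMatrix g' x i j).of_le (by norm_num))
      (isUnit_det_of_posDef (metricMatrix_posDef g x hev.self_of_nhds.1))
      (isUnit_det_of_posDef (metricMatrix_posDef g' x hev.self_of_nhds.1))
      ((contDiffAt_localComp hφ.1 x c).of_le (WithTop.coe_le_coe.2 le_top)) ?_
      (inv_ne_zero (ha0 _).ne') (hgrad c) hvol
    exact ((contDiffAt_comp_extChartAt_symm ha x).differentiableAt (by norm_num)).inv (ha0 _).ne'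
  rw [tensionField_eq, tensionField_eq]
  refine congrArg (WithLp.toLp 2) (funext fun c => ?_)
  change tensionComp g' h φ x c = (a x)⁻¹ * tensionComp g h φ x c
  rw [tensionComp, tensionComp, ← hy₀, hlap, ← hsx, mul_add]
  congr 1
  -- What remains is the quadratic term, linear in the gradient of the q-th component; its other
  -- factors do not involve the metric on M.
  simp only [Finset.mul_sum]
  refine Finset.sum_congr rfl fun p _ => Finset.sum_congr rfl fun q _ =>
    Finset.sum_congr rfl fun i _ => ?_
  rw [(hgrad q i).eq_of_nhds]
  ring

/-- Biconformal changes of metric multiply `dφ*` by `a⁻¹`. -/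
theorem adjointDifferential_biconformalMetric (g : Metric m M) (h : Metric k N)
    (hφ : IsSubmersion m k φ)
    (ha : ContMDiff (𝓡 m) 𝓘(ℝ, ℝ) ∞ a) (ht : ContMDiff (𝓡 m) 𝓘(ℝ, ℝ) ∞ t)
    (ha0 : ∀ x, 0 < a x) (ht0 : ∀ x, 0 < t x) (x : M) (w : TangentSpace (𝓡 k) (φ x)) :
    adjointDifferential (biconformalMetric g hφ ha ht ha0 ht0) h φ x w =
      (a x)⁻¹ • adjointDifferential g h φ x w := by
  set g' := biconformalMetric g hφ ha ht ha0 ht0 with hg'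
  set u := adjointDifferential g h φ x w with hu
  have hu_hor : u ∈ horizontal (k := k) g φ x := by
    intro v hv
    change g.inner x v u = 0
    rw [g.symm, adjointDifferential_spec, LinearMap.mem_ker.1 hv, map_zero]
  -- As u is horizontal, a⁻¹u satisfies the relation that defines the adjoint for g'; nondegeneracy
  -- then identifies the two.
  have key : ∀ v, g'.inner x ((a x)⁻¹ • u) v = g'.inner x (adjointDifferential g' h φ x w) v := by
    intro v
    have h1 : g'.inner x u v = a x * g.inner x u v := by
      have h2 : verticalProj (k := k) g φ x u = 0 := by
        rw [verticalProj_eq, horizontalProj_of_mem (k := k) g φ x hu_hor, sub_self]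
      refine (biconformalForm_apply (k := k) g x u v).trans ?_
      rw [horizontalPart_eq, horizontalProj_of_mem (k := k) g φ x hu_hor, verticalPart, h2,
        map_zero, _root_.zero_apply, mul_zero, add_zero]
    rw [adjointDifferential_spec, map_smul, _root_.smul_apply, h1, smul_eq_mul,
      inv_mul_cancel_left₀ (ha0 x).ne', adjointDifferential_spec]
  refine (sub_eq_zero.1 (form_eq_zero g' x ?_)).symm
  rw [form_apply, map_sub (g'.inner x), _root_.sub_apply, key, sub_self]

end TensionChange

/-! ### Powers of the scaling function -/

/-- With e the vertical exponent, the exponents satisfy me + 2n(-2 - e) = -4, which is (m - 2n)e =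
4n - 4. -/
theorem rpow_balance {m n : ℕ} (hmn : 2 * n < m) {r : ℝ} (hr : 0 < r) :
    (r ^ ((4 * (n : ℝ) - 4) / ((m : ℝ) - 2 * (n : ℝ)))) ^ m *
      (r ^ (-2 : ℝ) / r ^ ((4 * (n : ℝ) - 4) / ((m : ℝ) - 2 * (n : ℝ)))) ^ (2 * n) =
        (r ^ (-2 : ℝ)) ^ 2 := by
  have hmn' : (m : ℝ) - 2 * n ≠ 0 := by
    have : (2 * n : ℝ) < m := by exact_mod_cast hmn
    exact (sub_pos.2 this).ne'
  rw [← Real.rpow_sub hr, ← Real.rpow_mul_natCast hr.le, ← Real.rpow_mul_natCast hr.le,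
    ← Real.rpow_mul_natCast hr.le, ← Real.rpow_add hr]
  have he := div_mul_cancel₀ (4 * (n : ℝ) - 4) hmn'
  congr 1
  push_cast
  linear_combination he

theorem contMDiff_rpow {m : ℕ} {M : Type*} [TopologicalSpace M]
    [ChartedSpace (EuclideanSpace ℝ (Fin m)) M] {f : M → ℝ}
    (hf : ContMDiff (𝓡 m) 𝓘(ℝ, ℝ) ∞ f) (hf0 : ∀ x, 0 < f x) (e : ℝ) :
    ContMDiff (𝓡 m) 𝓘(ℝ, ℝ) ∞ fun x => f x ^ e := fun x =>
  ContDiffAt.comp_contMDiffAt (g := fun r : ℝ => r ^ e)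
    (Real.contDiffAt_rpow_const_of_ne (hf0 x).ne') (hf x)

end PseudoHarmonic

end

theorem mainTheorem2 (m n : ℕ) (hmn : 2 * n < m)
    {M : Type*} [TopologicalSpace M] [T2Space M] [SecondCountableTopology M]
    [ChartedSpace (EuclideanSpace ℝ (Fin m)) M] [IsManifold (𝓡 m) ∞ M]
    {N : Type*} [TopologicalSpace N] [T2Space N] [SecondCountableTopology N]
    [ChartedSpace (EuclideanSpace ℝ (Fin (2 * n))) N] [IsManifold (𝓡 (2 * n)) ∞ N]
    (g : PseudoHarmonic.Metric m M) (S : PseudoHarmonic.HermitianStructure (2 * n) N)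
    (φ : M → N) (hφ : PseudoHarmonic.IsSubmersion m (2 * n) φ)
    (hφ' : PseudoHarmonic.IsPHWC g S φ)
    (σ : M → ℝ) (hσ : ContMDiff (𝓡 m) 𝓘(ℝ, ℝ) ∞ σ) (hσ_pos : ∀ x, 0 < σ x) :
    ∃ gσ : PseudoHarmonic.Metric m M,
      (∀ (x : M) (v w : TangentSpace (𝓡 m) x),
        gσ.inner x v w =
          σ x ^ (-2 : ℝ) * PseudoHarmonic.horizontalPart (k := 2 * n) g φ x v w
          + σ x ^ ((4 * (n : ℝ) - 4) / ((m : ℝ) - 2 * (n : ℝ)))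
            * PseudoHarmonic.verticalPart (k := 2 * n) g φ x v w) ∧
      (PseudoHarmonic.IsPseudoHarmonicMorphism g S φ ↔
        PseudoHarmonic.IsPseudoHarmonicMorphism gσ S φ) := by
  have ha := PseudoHarmonic.contMDiff_rpow hσ hσ_pos (-2)
  have ht := PseudoHarmonic.contMDiff_rpow hσ hσ_pos
    ((4 * (n : ℝ) - 4) / ((m : ℝ) - 2 * (n : ℝ)))
  have ha0 : ∀ x, 0 < σ x ^ (-2 : ℝ) := fun x => Real.rpow_pos_of_pos (hσ_pos x) _
  have ht0 : ∀ x, 0 < σ x ^ ((4 * (n : ℝ) - 4) / ((m : ℝ) - 2 * (n : ℝ))) := fun x =>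
    Real.rpow_pos_of_pos (hσ_pos x) _
  refine ⟨PseudoHarmonic.biconformalMetric g hφ ha ht ha0 ht0,
    fun x v w => PseudoHarmonic.biconformalForm_apply g x v w, ?_⟩
  -- Both metrics are PHWC outright, by linearity of dφ and J, so the equivalence concerns
  -- harmonicity alone.
  have hPHWC : PseudoHarmonic.IsPHWC (PseudoHarmonic.biconformalMetric g hφ ha ht ha0 ht0) S φ := by
    intro x w
    rw [PseudoHarmonic.adjointDifferential_biconformalMetric,
      PseudoHarmonic.adjointDifferential_biconformalMetric, map_smul, map_smul, map_smul, hφ' x w]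
  have hτ : ∀ x, PseudoHarmonic.tensionField (PseudoHarmonic.biconformalMetric g hφ ha ht ha0 ht0)
      S.h φ x = 0 ↔ PseudoHarmonic.tensionField g S.h φ x = 0 := by
    intro x
    have h := PseudoHarmonic.tensionField_biconformalMetric g S.h hφ ha ht ha0 ht0
      (fun x => PseudoHarmonic.rpow_balance hmn (hσ_pos x)) x
    have h0 : (σ x ^ (-2 : ℝ))⁻¹ ≠ 0 := inv_ne_zero (ha0 x).ne'
    exact (Eq.congr_left h).trans (smul_eq_zero_iff_right h0)
  exact ⟨fun h => ⟨⟨h.1.1, fun x => (hτ x).2 (h.1.2 x)⟩, hPHWC⟩,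
    fun h => ⟨⟨h.1.1, fun x => (hτ x).1 (h.1.2 x)⟩, hφ'⟩⟩
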